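/- Let $\eta$ be a random variable with values in $\{0,1,2,\dots\}$, $\mathbf P[\eta\ge 1]>0$ and $\mathbf E\eta<\infty$. For $d\ge 3$ let $\mathbb T_d$ be the homogeneous tree of degree $d$ with a root $\mathbf 0$. For $p\in[0,1]$ consider the following frog model on $\mathbb T_d$. The numbers $\eta(x)$ of particles initially at the sites $x$ are i.i.d. copies of $\eta$; independently of them and of each other, the $i$-th particle from $x$ has a simple random walk trajectory $(S^x_n(i))_{n\ge 0}$ on $\mathbb T_d$ started at $x$ and a lifetime $\Xi^x(i)$ with $\mathbf P[\Xi^x(i)=k]=(1-p)p^{k-1}$, $k=1,2,\dots$ (and $\Xi^x(i)=\infty$ if $p=1$). Put $$t(x,y)=\min_{1\le i\le\eta(x)}\min\{n<\Xi^x(i): S^x_n(i)=y\},\qquad T(x)=\inf\{t(x_0,x_1)+\dots+t(x_{m-1},x_m)\},$$ with $\min\emptyset=\infty$ and the infimum over all finite sequences $\mathbf 0=x_0,x_1,\dots,x_m=x$. The $i$-th particle from $x$, $1\le i\le\eta(x)$, is active at time $n$ if $T(x)\le n<T(x)+\Xi^x(i)$. The model survives if at every time $n=0,1,2,\dots$ there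 is at least one active particle. Let $$p_c(\mathbb T_d,\eta)=\inf\{p\in[0,1]:\mathbf P[\text{the model with parameter }p\text{ survives}]>0\}.$$ Then $$\lim_{d\to\infty}p_c(\mathbb T_d,\eta)=\frac1{1+\mathbf E\eta}.$$ -/

import Mathlib

open MeasureTheory ProbabilityTheory Filter Topology

noncomputable section

namespace FrogModel

/-! ### The frog model with death on a locally finite graph -/

section Model

variable {V : Type*} [MeasurableSpace V]

/-- One step of simple random walk from `v`: a uniformly chosen neighbour of `v`.
(At a vertex without neighbours the walker stays; this never happens in an infinite
connected graph.) -/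
def stepPMF (G : SimpleGraph V) [G.LocallyFinite] (v : V) : PMF V :=
  open Classical in
  if h : (G.neighborFinset v).Nonempty then PMF.uniformOfFinset (G.neighborFinset v) h
  else PMF.pure v

/-- The transition kernel of simple random walk on `G`. -/
def stepKernel [DiscreteMeasurableSpace V] (G : SimpleGraph V) [G.LocallyFinite] :
    Kernel V V where
  toFun v := (stepPMF G v).toMeasure
  measurable' := Measurable.of_discrete

instance [DiscreteMeasurableSpace V] (G : SimpleGraph V) [G.LocallyFinite] :
    IsMarkovKernel (stepKernel G) :=
  ⟨fun v => inferInstanceAs (IsProbabilityMeasure (stepPMF G v).toMeasure)⟩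

/-- The law on trajectories of simple random walk `(S_n)` on `G` with `S_0 = x`: the Markov
chain with transition kernel `stepKernel G` started at `x`. -/
def srwLaw [DiscreteMeasurableSpace V] (G : SimpleGraph V) [G.LocallyFinite] (x : V) :
    Measure (ℕ → V) :=
  Kernel.traj (X := fun _ => V)
    (fun n => (stepKernel G).comap (fun h => h ⟨n, Finset.mem_Iic.2 le_rfl⟩)
      (measurable_pi_apply _)) 0 (fun _ => x)

instance [DiscreteMeasurableSpace V] (G : SimpleGraph V) [G.LocallyFinite] (x : V) :
    IsProbabilityMeasure (srwLaw G x) := by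
  unfold srwLaw; infer_instance

/-- The law of the lifetime: `P[Ξ = k] = (1 - p) p ^ (k - 1)` for `k = 1, 2, …`;
for `p = 1` the particle never dies, `Ξ = ∞`.
(`geometricMeasure q` is the law on `{0, 1, 2, …}` with weights `(1 - q) ^ n * q`.) -/
def lifetimeLaw (p : unitInterval) : Measure ℕ∞ :=
  open Classical in
  if p = 1 then Measure.dirac ⊤
  else (geometricMeasure (unitInterval.symm p)).map (fun n : ℕ => ((n + 1 : ℕ) : ℕ∞))

instance (p : unitInterval) : IsProbabilityMeasure (lifetimeLaw p) := by
  unfold lifetimeLaw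
  split_ifs
  · infer_instance
  · exact Measure.isProbabilityMeasure_map (Measurable.of_discrete).aemeasurable

/-- A realization: for every site `x`, the number `η(x)` of particles placed at `x` and, for
every index `i = 0, 1, 2, …`, the trajectory and the lifetime of the `i`-th particle from `x`.
Only the particles with index `i < η(x)` are present. -/
abbrev Config (V : Type*) := V → ℕ × (ℕ → (ℕ → V) × ℕ∞)

/-- The number of particles initially at `x`. -/
def Config.eta (ω : Config V) (x : V) : ℕ := (ω x).1

/-- The position after `n` steps of the `i`-th particle from `x`. -/
def Config.walk (ω : Config V) (x : V) (i n : ℕ) : V := ((ω x).2 i).1 n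

/-- The lifetime of the `i`-th particle from `x`. -/
def Config.life (ω : Config V) (x : V) (i : ℕ) : ℕ∞ := ((ω x).2 i).2

/-- The law of the realization: everything is independent, `η(x)` has law `ν`, the trajectories
of the particles from `x` are simple random walks on `G` started at `x`, the lifetimes are
geometric with survival parameter `p`. -/
def frogLaw [DiscreteMeasurableSpace V] (G : SimpleGraph V) [G.LocallyFinite]
    (ν : Measure ℕ) [IsProbabilityMeasure ν] (p : unitInterval) : Measure (Config V) :=
  Measure.infinitePi fun x : V =>
    ν.prod (Measure.infinitePi fun _ : ℕ => (srwLaw G x).prod (lifetimeLaw p))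

/-- `t(x, y)`: the least number of steps in which some particle from `x`, counting from its
activation and while it is alive, reaches `y` (`∞` if there is none). -/
def hitTime (ω : Config V) (x y : V) : ℕ∞ :=
  ⨅ (i : ℕ) (_ : i < ω.eta x) (n : ℕ) (_ : (n : ℕ∞) < ω.life x i) (_ : ω.walk x i n = y), (n : ℕ∞)

/-- `T(x)`: the moment at which the particles of `x` are awakened, i.e. the infimum of
`t(x_0, x_1) + ⋯ + t(x_{m-1}, x_m)` over finite sequences of sites with `x_0 = o` (the root)
and `x_m = x`. -/
def wakeTime (o : V) (ω : Config V) (x : V) : ℕ∞ :=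
  ⨅ (m : ℕ) (γ : Fin (m + 1) → V) (_ : γ 0 = o) (_ : γ (Fin.last m) = x),
    ∑ k : Fin m, hitTime ω (γ k.castSucc) (γ k.succ)

/-- The `i`-th particle from `x` exists and is active at time `n`: it has been awakened, and has
not yet died (it dies `Ξ` units of time after its activation). -/
def ActiveAt (o : V) (ω : Config V) (x : V) (i n : ℕ) : Prop :=
  i < ω.eta x ∧ wakeTime o ω x ≤ n ∧ (n : ℕ∞) < wakeTime o ω x + ω.life x i

/-- The realization survives: at every instant of time there is an active particle. -/
def Survives (o : V) (ω : Config V) : Prop :=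
  ∀ n : ℕ, ∃ (x : V) (i : ℕ), ActiveAt o ω x i n

/-- The critical probability `p_c(G, η)` of the frog model on `G` with root `o`, where `ν` is the
law of `η`: the infimum of the `p ∈ [0, 1]` for which survival has positive probability. -/
def criticalProb [DiscreteMeasurableSpace V] (G : SimpleGraph V) [G.LocallyFinite] (o : V)
    (ν : Measure ℕ) [IsProbabilityMeasure ν] : ℝ :=
  sInf {r : ℝ | ∃ p : unitInterval, (p : ℝ) = r ∧ 0 < frogLaw G ν p {ω | Survives o ω}}

end Model

/-! ### The homogeneous tree of degree `d` -/

/-- The vertices of the tree: words in `d` letters without two equal consecutive letters. -/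
abbrev TreeVertex (d : ℕ) := {w : List (Fin d) // w.IsChain (· ≠ ·)}

instance (d : ℕ) : MeasurableSpace (TreeVertex d) := ⊤

instance (d : ℕ) : DiscreteMeasurableSpace (TreeVertex d) := ⟨fun _ => trivial⟩

/-- The root: the empty word. -/
def treeRoot (d : ℕ) : TreeVertex d := ⟨[], List.IsChain.nil⟩

/-- The homogeneous tree of degree `d`: two words are adjacent iff one of them arises from the
other by putting one letter in front. -/
def regTree (d : ℕ) : SimpleGraph (TreeVertex d) where
  Adj u v := ∃ a : Fin d, u.1 = a :: v.1 ∨ v.1 = a :: u.1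
  symm := ⟨fun _ _ ⟨a, h⟩ => ⟨a, h.symm⟩⟩
  loopless := ⟨fun u ⟨a, h⟩ => by
    rcases h with h | h <;> simpa using congrArg List.length h⟩

/-- The neighbour of `w` in direction `a`: remove the first letter if it is `a`, otherwise put
`a` in front. -/
def treeMove {d : ℕ} (w : TreeVertex d) (a : Fin d) : TreeVertex d :=
  match w with
  | ⟨[], _⟩ => ⟨[a], by simp⟩
  | ⟨b :: l, h⟩ => if hab : a = b then ⟨l, h.tail⟩ else ⟨a :: b :: l, by simp [hab, h]⟩

theorem treeMove_injective {d : ℕ} (w : TreeVertex d) : Function.Injective (treeMove w) := by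
  rintro a a' h
  obtain ⟨_ | ⟨b, l⟩, hw⟩ := w
  · simpa [treeMove] using h
  · simp only [treeMove] at h
    split_ifs at h with h1 h2 h2
    · exact h1.trans h2.symm
    · have := congrArg (fun u => u.1.length) h
      simp at this; omega
    · have := congrArg (fun u => u.1.length) h
      simp at this; omega
    · simpa using h

theorem range_treeMove {d : ℕ} (w : TreeVertex d) :
    Set.range (treeMove w) = (regTree d).neighborSet w := by
  ext u
  simp only [Set.mem_range, SimpleGraph.mem_neighborSet, regTree]
  obtain ⟨_ | ⟨b, l⟩, hw⟩ := w
  · obtain ⟨u, hu⟩ := u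
    simp [treeMove, eq_comm]
  · constructor
    · rintro ⟨a, rfl⟩
      by_cases hab : a = b
      · exact ⟨a, Or.inl (by simp [treeMove, hab])⟩
      · exact ⟨a, Or.inr (by simp [treeMove, hab])⟩
    · obtain ⟨u, hu⟩ := u
      rintro ⟨a, h | h⟩
      · simp only [List.cons.injEq] at h
        obtain ⟨rfl, rfl⟩ := h
        exact ⟨b, by simp [treeMove]⟩
      · simp only at h
        subst h
        have : a ≠ b := by simpa using (List.isChain_cons_cons.1 hu).1
        exact ⟨a, by simp [treeMove, this]⟩

instance (d : ℕ) : (regTree d).LocallyFinite := fun w =>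
  Fintype.ofEquiv (Fin d)
    ((Equiv.ofInjective _ (treeMove_injective w)).trans (Equiv.setCongr (range_treeMove w)))

theorem regTree_isRegularOfDegree (d : ℕ) : (regTree d).IsRegularOfDegree d := fun w => by
  rw [← SimpleGraph.card_neighborSet_eq_degree, ← Fintype.card_congr
    ((Equiv.ofInjective _ (treeMove_injective w)).trans (Equiv.setCongr (range_treeMove w))),
    Fintype.card_fin]

theorem regTree_connected (d : ℕ) : (regTree d).Connected := by
  have key : ∀ (l : List (Fin d)) (h : l.IsChain (· ≠ ·)),
      (regTree d).Reachable ⟨l, h⟩ (treeRoot d) := by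
    intro l
    induction l with
    | nil => intro h; exact SimpleGraph.Reachable.refl _
    | cons a l ih =>
      intro h
      have hadj : (regTree d).Adj ⟨a :: l, h⟩ ⟨l, h.tail⟩ := ⟨a, Or.inl rfl⟩
      exact hadj.reachable.trans (ih _)
  have : Nonempty (TreeVertex d) := ⟨treeRoot d⟩
  exact ⟨fun u v => (key u.1 u.2).trans (key v.1 v.2).symm⟩

theorem regTree_isAcyclic (d : ℕ) : (regTree d).IsAcyclic := by
  classical
  intro v c hc
  obtain ⟨u, hu, hmax⟩ := Finset.exists_max_image c.support.toFinset
    (fun w => w.1.length) ⟨v, by simp⟩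
  have hu' : u ∈ c.support := by simpa using hu
  have hc' := hc.rotate hu'
  have hle : ∀ w ∈ (c.rotate u hu').support, w.1.length ≤ u.1.length := by
    intro w hw
    exact hmax w (by simpa using hw)
  have tail_eq : ∀ w : TreeVertex d, (regTree d).Adj u w → w.1.length ≤ u.1.length →
      w.1 = u.1.tail := by
    rintro w ⟨a, h | h⟩ hl
    · simp [h]
    · rw [h] at hl; simp at hl
  refine hc'.snd_ne_penultimate (Subtype.ext ?_)
  rw [tail_eq _ (SimpleGraph.Walk.adj_snd hc'.not_nil) (hle _ (SimpleGraph.Walk.getVert_mem_support _ _)),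
    tail_eq _ (SimpleGraph.Walk.adj_penultimate hc'.not_nil).symm
      (hle _ (SimpleGraph.Walk.getVert_mem_support _ _))]

theorem regTree_isTree (d : ℕ) : (regTree d).IsTree :=
  ⟨regTree_connected d, regTree_isAcyclic d⟩

end FrogModel

end

/-! Write m for the mean of η. A chain of activations lasting n steps splits n into jump lengths,
and the expected number of particles of a site still alive after k steps is m p^k. Summed over the
compositions of n this gives m (1+m)^(n-1) p^n, with growth rate p(1+m). The rate bounds the process
from above on every graph and is nearly attained on trees of large degree, where almost every step
leads away from the root.

Bound from below on the critical value: a particle active at time n yields, after loop erasure, a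
chain of distinct sites along which activity lasts beyond n (`ActiveAt.mem_longChain`). Since the
sites are distinct, each jump is independent of what follows, and a union bound gives at most m
(p(1+m))^n (`frogLaw_longChain_le`). If p(1+m) < 1 this tends to zero, so survival is null in every
degree.

Bound from above: let p < 1 and p(1+m) > 1. Only the first M particles of each site are kept,
because η need not have a second moment, and only those moving straight away from the root. If the
furthest of these is always the one followed, different first jumps are disjoint events. The
probability of reaching a given descendant n generations away is then at least c (1+c)^(n-1)
(p/d)^n, where c is the truncated mean minus O(1/d) (`le_frogLaw_reach`). There are (d-1)^N
descendants in generation N, so the expected number reached tends to p^N c (1+c)^(N-1) with c now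
the truncated mean; this exceeds one for suitable M and N. A second moment bound uniform in the
number of N-generation blocks (`le_frogLaw_blockSurvives`) gives unbounded spread with positive
probability. Straight motion makes wake times equal to distances, so activity has no gaps in time.
-/

open scoped ENNReal

noncomputable section

namespace FrogModel

/-! ### Independence of sites and particles; the Markov property -/

section Basics

set_option linter.unusedSectionVars false

variable {V : Type*} [MeasurableSpace V]

/-- The events that depend only on the particles starting in `S`. -/
@[reducible] def siteSigma (V : Type*) [MeasurableSpace V] (S : Set V) : MeasurableSpace (Config V) :=
  ⨆ x ∈ S, MeasurableSpace.comap (fun ω : Config V => ω x) inferInstance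

theorem siteSigma_mono {S T : Set V} (h : S ⊆ T) : siteSigma V S ≤ siteSigma V T :=
  biSup_mono h

theorem siteSigma_le (S : Set V) : siteSigma V S ≤ MeasurableSpace.pi :=
  iSup₂_le fun x _ => (measurable_pi_apply x).comap_le

theorem measurableSet_siteSigma_preimage {S : Set V} {x : V} (hx : x ∈ S)
    {C : Set (ℕ × (ℕ → (ℕ → V) × ℕ∞))} (hC : MeasurableSet C) :
    MeasurableSet[siteSigma V S] {ω : Config V | ω x ∈ C} :=
  (le_iSup₂_of_le (f := fun x (_ : x ∈ S) =>
    MeasurableSpace.comap (fun ω : Config V => ω x) inferInstance) x hx le_rfl) _ ⟨C, hC, rfl⟩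

variable [DiscreteMeasurableSpace V]

/-- The law of the particles starting at `x`. -/
def siteLaw (G : SimpleGraph V) [G.LocallyFinite] (ν : Measure ℕ) (p : unitInterval)
    (x : V) : Measure (ℕ × (ℕ → (ℕ → V) × ℕ∞)) :=
  ν.prod (Measure.infinitePi fun _ : ℕ => (srwLaw G x).prod (lifetimeLaw p))

variable (G : SimpleGraph V) [G.LocallyFinite] (ν : Measure ℕ) [IsProbabilityMeasure ν]
  (p : unitInterval)

instance (x : V) : IsProbabilityMeasure (siteLaw G ν p x) := by
  unfold siteLaw; infer_instance

theorem frogLaw_eq : frogLaw G ν p = Measure.infinitePi (siteLaw G ν p) := rfl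

instance : IsProbabilityMeasure (frogLaw G ν p) := by
  rw [frogLaw_eq]; infer_instance

theorem frogLaw_site (x : V) {C : Set (ℕ × (ℕ → (ℕ → V) × ℕ∞))} (hC : MeasurableSet C) :
    frogLaw G ν p {ω | ω x ∈ C} = siteLaw G ν p x C := by
  rw [frogLaw_eq, ← Measure.infinitePi_map_eval (siteLaw G ν p) x,
    Measure.map_apply (measurable_pi_apply x) hC]
  rfl

/-- Different sites are independent, hence so are disjoint groups of them. The events in both halves
of the proof are built so that this applies: a jump looks at one site, its continuation at others.
-/
theorem frogLaw_inter {S T : Set V} (hST : Disjoint S T) {A B : Set (Config V)}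
    (hA : MeasurableSet[siteSigma V S] A) (hB : MeasurableSet[siteSigma V T] B) :
    frogLaw G ν p (A ∩ B) = frogLaw G ν p A * frogLaw G ν p B := by
  have h : iIndepFun (fun x (ω : Config V) => ω x) (Measure.infinitePi (siteLaw G ν p)) :=
    iIndepFun_infinitePi (P := siteLaw G ν p) (X := fun _ c => c) fun _ => measurable_id
  have h2 := indep_iSup_of_disjoint (fun x => (measurable_pi_apply x).comap_le) h.iIndep hST
  rw [frogLaw_eq]
  exact (Indep_iff _ _ _).1 h2 A B hA hB

/-- The law of the trajectory and the lifetime of one particle. -/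
def particleLaw (x : V) : Measure ((ℕ → V) × ℕ∞) := (srwLaw G x).prod (lifetimeLaw p)

instance (x : V) : IsProbabilityMeasure (particleLaw G p x) := by
  unfold particleLaw; infer_instance

theorem siteLaw_particle (x : V) (i : ℕ) {C : Set ((ℕ → V) × ℕ∞)} (hC : MeasurableSet C) :
    siteLaw G ν p x {s | i < s.1 ∧ s.2 i ∈ C} = ν {n | i < n} * particleLaw G p x C := by
  have : {s : ℕ × (ℕ → (ℕ → V) × ℕ∞) | i < s.1 ∧ s.2 i ∈ C} =
      {n | i < n} ×ˢ ((fun f => f i) ⁻¹' C) := by ext; simp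
  rw [this, siteLaw, Measure.prod_prod, ← Measure.map_apply (measurable_pi_apply i) hC,
    Measure.infinitePi_map_eval (fun _ : ℕ => (srwLaw G x).prod (lifetimeLaw p)) i]
  rfl

/-- The presence of two particles at a site is correlated through η. An upper bound may ignore
presence, and the remaining data of the two particles are independent. -/
theorem siteLaw_pair_le (x : V) {i j : ℕ} (hij : i ≠ j) {C : Set ((ℕ → V) × ℕ∞)}
    (hC : MeasurableSet C) :
    siteLaw G ν p x {s | s.2 i ∈ C ∧ s.2 j ∈ C} ≤ particleLaw G p x C ^ 2 := by
  have : {s : ℕ × (ℕ → (ℕ → V) × ℕ∞) | s.2 i ∈ C ∧ s.2 j ∈ C} =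
      Set.univ ×ˢ ((fun f => (f i, f j)) ⁻¹' (C ×ˢ C)) := by ext; simp
  rw [this, siteLaw, Measure.prod_prod, ← Measure.map_apply (by fun_prop) (hC.prod hC),
    Measure.infinitePi_map_eval_prod (P := fun _ : ℕ => (srwLaw G x).prod (lifetimeLaw p)) hij,
    Measure.prod_prod]
  simp [particleLaw, sq]

theorem lifetimeLaw_lt (hp : p ≠ 1) (k : ℕ) :
    lifetimeLaw p {l | (k : ℕ∞) < l} = ENNReal.ofReal p ^ k := by
  have h0 : unitInterval.symm p ≠ 0 := by simpa using hp
  have hle : (p : ℝ) ≤ 1 := p.2.2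
  have hlt : (p : ℝ) < 1 := lt_of_le_of_ne hle fun h => hp (Subtype.ext h)
  rw [lifetimeLaw, if_neg hp, Measure.map_apply Measurable.of_discrete MeasurableSet.of_discrete,
    geometricMeasure_eq h0, Measure.sum_apply _ MeasurableSet.of_discrete]
  have e : (fun n : ℕ => ((n + 1 : ℕ) : ℕ∞)) ⁻¹' {l | (k : ℕ∞) < l} = {n | k ≤ n} := by
    ext n
    simp only [Set.mem_preimage, Set.mem_ofPred_eq, Nat.cast_lt]
    omega
  rw [e]
  have hs : HasSum (fun n : ℕ => (p : ℝ) ^ (n + k) * (1 - p)) ((p : ℝ) ^ k) := by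
    have := ((hasSum_geometric_of_lt_one p.2.1 hlt).mul_right ((p : ℝ) ^ k * (1 - p)))
    have hne : (1 - (p : ℝ)) ≠ 0 := by linarith
    have e1 : (1 - (p : ℝ))⁻¹ * ((p : ℝ) ^ k * (1 - p)) = (p : ℝ) ^ k := by field_simp
    rw [e1] at this
    refine this.congr_fun ?_
    intro n
    ring
  have hterm : ∀ n : ℕ, (ENNReal.ofReal ((1 - (unitInterval.symm p : ℝ)) ^ n
      * (unitInterval.symm p : ℝ)) • Measure.dirac n) {n : ℕ | k ≤ n}
      = if k ≤ n then ENNReal.ofReal ((p : ℝ) ^ n * (1 - p)) else 0 := by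
    intro n
    simp [Set.indicator_apply]
  simp_rw [hterm]
  rw [← (Summable.sum_add_tsum_nat_add' (f := fun n => if k ≤ n then
      ENNReal.ofReal ((p : ℝ) ^ n * (1 - p)) else 0) (k := k) ENNReal.summable)]
  rw [Finset.sum_eq_zero fun n hn => if_neg (by simpa using hn), zero_add]
  simp only [le_add_iff_nonneg_left, zero_le, if_true]
  rw [← ENNReal.ofReal_pow p.2.1, ← hs.tsum_eq,
    ENNReal.ofReal_tsum_of_nonneg _ hs.summable]
  intro n
  have := p.2.1
  have : (0 : ℝ) ≤ 1 - p := by linarith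
  positivity

theorem particleLaw_alive (hp : p ≠ 1) (x : V) (A : Set (ℕ → V)) (k : ℕ) :
    particleLaw G p x {c | (k : ℕ∞) < c.2 ∧ c.1 ∈ A} = ENNReal.ofReal p ^ k * srwLaw G x A := by
  have : {c : (ℕ → V) × ℕ∞ | (k : ℕ∞) < c.2 ∧ c.1 ∈ A} = A ×ˢ {l | (k : ℕ∞) < l} := by
    ext c; simp [and_comm]
  rw [this, particleLaw, Measure.prod_prod, lifetimeLaw_lt p hp, mul_comm]

/-- Markov property: the prefix event pins the position at time n to u, so the transition kernel is
constant on it and the integral over the prefix law factors. -/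
theorem srwLaw_step (x : V) (n : ℕ) {A : Set (Finset.Iic n → V)} (hA : MeasurableSet A) (u v : V)
    (hu : ∀ h ∈ A, h ⟨n, Finset.mem_Iic.2 le_rfl⟩ = u) :
    srwLaw G x {w | (fun l : Finset.Iic n => w l) ∈ A ∧ w (n + 1) = v} =
      srwLaw G x {w | (fun l : Finset.Iic n => w l) ∈ A} * stepPMF G u v := by
  have key := Kernel.partialTraj_compProd_eq_map_traj (X := fun _ => V)
    (κ := fun n => (stepKernel G).comap (fun h => h ⟨n, Finset.mem_Iic.2 le_rfl⟩)
      (measurable_pi_apply _)) (zero_le : 0 ≤ n) (x₀ := fun _ => x)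
  have hmv : MeasurableSet (A ×ˢ ({v} : Set V)) := hA.prod (MeasurableSet.singleton v)
  have h1 := congrArg (fun μ => μ (A ×ˢ ({v} : Set V))) key
  beta_reduce at h1
  rw [Measure.map_apply (by fun_prop) hmv, Measure.compProd_apply_prod hA (.singleton v)] at h1
  have h2 : ∀ h ∈ A, ((stepKernel G).comap (fun h : Finset.Iic n → V =>
      h ⟨n, Finset.mem_Iic.2 le_rfl⟩) (measurable_pi_apply _)) h {v} = stepPMF G u v := by
    intro h hh
    rw [Kernel.comap_apply, hu h hh]
    exact PMF.toMeasure_apply_singleton _ _ (.singleton v)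
  rw [setLIntegral_congr_fun hA (g := fun _ => stepPMF G u v) h2, setLIntegral_const,
    ← Kernel.traj_map_frestrictLe_apply, Measure.map_apply (by fun_prop) hA] at h1
  rw [mul_comm]
  exact h1.symm

theorem srwLaw_zero (x : V) : srwLaw G x {w | w 0 = x} = 1 := by
  have h := Kernel.traj_map_frestrictLe_apply (X := fun _ => V)
    (κ := fun n => (stepKernel G).comap (fun h => h ⟨n, Finset.mem_Iic.2 le_rfl⟩)
      (measurable_pi_apply _)) 0 0 (fun _ => x)
  rw [Kernel.partialTraj_self] at h
  have hm : MeasurableSet {h : Finset.Iic 0 → V | h ⟨0, by simp⟩ = x} :=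
    measurable_pi_apply (X := fun _ : Finset.Iic 0 => V) (⟨0, by simp⟩ : Finset.Iic 0)
      (MeasurableSet.singleton x)
  have h1 := congrArg (fun μ => μ {h : Finset.Iic 0 → V | h ⟨0, by simp⟩ = x}) h
  beta_reduce at h1
  rw [Measure.map_apply (by fun_prop) hm, Kernel.id_apply, Measure.dirac_apply' _ hm] at h1
  unfold srwLaw
  simpa using h1

theorem srwLaw_path_succ [Countable V] (x : V) (g : ℕ → V) (n : ℕ) :
    srwLaw G x {w | ∀ l ≤ n + 1, w l = g l} =
      srwLaw G x {w | ∀ l ≤ n, w l = g l} * stepPMF G (g n) (g (n + 1)) := by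
  have h := srwLaw_step G x n (A := {h | ∀ l, h l = g l})
    (by
      simp only [Set.ofPred_forall]
      exact MeasurableSet.iInter fun l => measurable_pi_apply l (.singleton _))
    (g n) (g (n + 1)) (fun h hh => hh _)
  have e : ∀ w : ℕ → V, (∀ l ≤ n, w l = g l) ↔
      (fun l : Finset.Iic n => w l) ∈ {h : Finset.Iic n → V | ∀ l, h l = g l} := by
    intro w
    simp
  simp only [← e] at h
  rw [← h]
  congr 1
  ext w
  simp only [Set.mem_ofPred_eq]
  refine ⟨fun H => ⟨fun l hl => H l (by omega), H _ le_rfl⟩, fun H l hl => ?_⟩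
  rcases Nat.lt_or_ge n l with h' | h'
  · obtain rfl : l = n + 1 := by omega
    exact H.2
  · exact H.1 l h'

theorem srwLaw_nonadj (x : V) (n : ℕ) (u v : V) (h : stepPMF G u v = 0) :
    srwLaw G x {w | w n = u ∧ w (n + 1) = v} = 0 := by
  have := srwLaw_step G x n (A := {h | h ⟨n, Finset.mem_Iic.2 le_rfl⟩ = u})
    (measurable_pi_apply (⟨n, Finset.mem_Iic.2 le_rfl⟩ : Finset.Iic n) (.singleton _)) u v
    (fun _ hh => hh)
  rw [h, mul_zero] at this
  exact this

theorem ae_particle [Countable V] (P : V → (ℕ → V) → Prop)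
    (hP : ∀ x, ∀ᵐ w ∂srwLaw G x, P x w) :
    ∀ᵐ ω ∂frogLaw G ν p, ∀ x i, P x (fun n => ω.walk x i n) := by
  rw [ae_all_iff]; intro x
  rw [ae_all_iff]; intro i
  have h1 : MeasurePreserving (fun ω : Config V => ω x) (frogLaw G ν p) (siteLaw G ν p x) :=
    measurePreserving_eval_infinitePi (siteLaw G ν p) x
  have h2 : MeasurePreserving (fun s : ℕ × (ℕ → (ℕ → V) × ℕ∞) => s.2) (siteLaw G ν p x) _ :=
    measurePreserving_snd
  have h3 := measurePreserving_eval_infinitePi (fun _ : ℕ => (srwLaw G x).prod (lifetimeLaw p)) i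
  have h4 : MeasurePreserving (Prod.fst : (ℕ → V) × ℕ∞ → _)
    ((srwLaw G x).prod (lifetimeLaw p)) _ := measurePreserving_fst
  exact (h4.comp (h3.comp (h2.comp h1))).quasiMeasurePreserving.ae (hP x)

end Basics

/-! ### Deterministic part: wake times, loop erasure and long chains -/

section Chains

variable {V : Type*}

/-- Some particle from `x` is alive and at `y` after `k` steps. -/
def Jump (ω : Config V) (x y : V) (k : ℕ) : Prop :=
  ∃ i < ω.eta x, (k : ℕ∞) < ω.life x i ∧ ω.walk x i k = y

theorem Jump.hitTime_le {ω : Config V} {x y : V} {k : ℕ} (h : Jump ω x y k) :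
    hitTime ω x y ≤ k := by
  obtain ⟨i, hi, hl, hw⟩ := h
  exact iInf_le_of_le i (iInf_le_of_le hi (iInf_le_of_le k (iInf_le_of_le hl (iInf_le _ hw))))

theorem exists_jump_of_hitTime_le {ω : Config V} {x y : V} {t : ℕ} (h : hitTime ω x y ≤ t) :
    ∃ k ≤ t, Jump ω x y k := by
  -- The strict form of the bound makes `iInf_lt_iff` produce a witness; a finite infimum in `ℕ∞` is
  -- attained.
  have h' : hitTime ω x y < (t + 1 : ℕ) := h.trans_lt (by exact_mod_cast Nat.lt_succ_self t)
  simp only [hitTime, iInf_lt_iff] at h'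
  obtain ⟨i, hi, k, hk, hw, hlt⟩ := h'
  exact ⟨k, by have := Nat.cast_lt.1 hlt; omega, i, hi, hk, hw⟩

theorem exists_chain_of_wakeTime_le {o x : V} {ω : Config V} {t : ℕ}
    (h : wakeTime o ω x ≤ t) :
    ∃ (m : ℕ) (γ : Fin (m + 1) → V), γ 0 = o ∧ γ (Fin.last m) = x ∧
      ∑ k : Fin m, hitTime ω (γ k.castSucc) (γ k.succ) ≤ t := by
  have h' : wakeTime o ω x < (t + 1 : ℕ) := h.trans_lt (by exact_mod_cast Nat.lt_succ_self t)
  simp only [wakeTime, iInf_lt_iff] at h'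
  obtain ⟨m, γ, h0, h1, hlt⟩ := h'
  refine ⟨m, γ, h0, h1, ?_⟩
  push_cast at hlt
  exact ENat.lt_add_one_iff (by simp) |>.1 hlt

theorem wakeTime_le_of_chain (ω : Config V) {m : ℕ} (γ : Fin (m + 1) → V) :
    wakeTime (γ 0) ω (γ (Fin.last m)) ≤ ∑ k : Fin m, hitTime ω (γ k.castSucc) (γ k.succ) :=
  iInf_le_of_le m (iInf_le_of_le γ (iInf_le_of_le rfl (iInf_le _ rfl)))

theorem wakeTime_self (ω : Config V) (x : V) : wakeTime x ω x = 0 :=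
  le_antisymm (by simpa using wakeTime_le_of_chain ω (m := 0) fun _ => x) bot_le

theorem wakeTime_le_hitTime_add (ω : Config V) (x x' y : V) {t : ℕ}
    (h : wakeTime x' ω y ≤ t) : wakeTime x ω y ≤ hitTime ω x x' + t := by
  obtain ⟨m, γ, h0, h1, hs⟩ := exists_chain_of_wakeTime_le h
  have := wakeTime_le_of_chain ω (Fin.cons x γ : Fin (m + 1 + 1) → V)
  rw [Fin.sum_univ_succ, ← Fin.succ_last, Fin.cons_zero, Fin.cons_succ, h1] at this
  refine this.trans (add_le_add ?_ ?_)
  · simp [h0]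
  · refine le_of_eq_of_le (Finset.sum_congr rfl fun k _ => ?_) hs
    simp

theorem wakeTime_le_add_hitTime (ω : Config V) (o x y : V) {t : ℕ}
    (h : wakeTime o ω x ≤ t) : wakeTime o ω y ≤ t + hitTime ω x y := by
  obtain ⟨m, γ, h0, h1, hs⟩ := exists_chain_of_wakeTime_le h
  have := wakeTime_le_of_chain ω (Fin.snoc γ y : Fin (m + 1 + 1) → V)
  rw [Fin.sum_univ_castSucc, Fin.snoc_last, ← Fin.castSucc_zero, Fin.snoc_castSucc, h0] at this
  refine this.trans (add_le_add ?_ ?_)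
  · refine le_of_eq_of_le (Finset.sum_congr rfl fun k _ => ?_) hs
    rw [← Fin.castSucc_succ, Fin.snoc_castSucc, Fin.snoc_castSucc]
  · rw [Fin.snoc_castSucc, Fin.succ_last, Fin.snoc_last, h1]

/-- `SimplePath ω F x y t`: a sequence of distinct sites outside `F` from `x` to `y`, each one
reached by a particle from the preceding one, in total time `t`. -/
inductive SimplePath (ω : Config V) : Set V → V → V → ℕ → Prop
  | nil {F : Set V} {x : V} (hx : x ∉ F) : SimplePath ω F x x 0
  | cons {F : Set V} {x x' y : V} {k t : ℕ} (hx : x ∉ F) (hj : Jump ω x x' k)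
      (h : SimplePath ω (insert x F) x' y t) : SimplePath ω F x y (k + t)

namespace SimplePath

variable {ω : Config V}

theorem notMem {F : Set V} {x y : V} {t : ℕ} (h : SimplePath ω F x y t) : x ∉ F := by
  cases h <;> assumption

theorem mono {F : Set V} {x y : V} {t : ℕ} (h : SimplePath ω F x y t) :
    ∀ {F' : Set V}, F' ⊆ F → SimplePath ω F' x y t := by
  induction h with
  | nil hx => exact fun hF => nil fun h => hx (hF h)
  | cons hx hj _ ih => exact fun hF => cons (fun h => hx (hF h)) hj (ih (Set.insert_subset_insert hF))

/-- Loop erasure: if the path visits x, the part before that visit is cut off. What is left starts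
at x and takes no longer. -/
theorem avoid_or_start {F : Set V} {x' y : V} {t : ℕ} (h : SimplePath ω F x' y t) (x : V) :
    x ∉ F → SimplePath ω (insert x F) x' y t ∨ ∃ t' ≤ t, SimplePath ω F x y t' := by
  induction h with
  | @nil F z hz =>
    intro hx
    by_cases hxz : x = z
    · exact Or.inr ⟨0, le_rfl, hxz ▸ nil hx⟩
    · exact Or.inl (nil (by simp [hz, Ne.symm hxz]))
  | @cons F z z' y k t hz hj hp ih =>
    intro hx
    by_cases hxz : x = z
    · subst hxz
      exact Or.inr ⟨_, le_rfl, cons hx hj hp⟩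
    · rcases ih (by simp [hx, hxz]) with h | ⟨t', ht', h⟩
      · exact Or.inl (cons (by simp [hz, Ne.symm hxz]) hj (by rwa [Set.insert_comm]))
      · exact Or.inr ⟨t', by omega, h.mono (Set.subset_insert _ _)⟩

theorem of_chain : ∀ (m : ℕ) (γ : Fin (m + 1) → V) (t : ℕ),
    ∑ k : Fin m, hitTime ω (γ k.castSucc) (γ k.succ) ≤ t →
    ∃ t' ≤ t, SimplePath ω ∅ (γ 0) (γ (Fin.last m)) t'
  | 0, γ, t, _ => ⟨0, Nat.zero_le _, nil (by simp)⟩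
  | m + 1, γ, t, h => by
    rw [Fin.sum_univ_succ] at h
    have h1 := le_self_add.trans h
    have h2 := le_add_self.trans h
    lift hitTime ω (γ (Fin.castSucc 0)) (γ (Fin.succ 0)) to ℕ using
      ne_top_of_le_ne_top (by simp) h1 with a ha
    lift ∑ i : Fin m, hitTime ω (γ i.succ.castSucc) (γ i.succ.succ) to ℕ using
      ne_top_of_le_ne_top (by simp) h2 with b hb
    obtain ⟨t', ht', hp⟩ := of_chain m (fun k => γ k.succ) b (by rw [hb]; rfl)
    obtain ⟨k, hk, hj⟩ := exists_jump_of_hitTime_le ha.symm.le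
    have hab : a + b ≤ t := by exact_mod_cast h
    rcases hp.avoid_or_start (γ 0) (by simp) with hp | ⟨s, hs, hp⟩
    · exact ⟨k + t', by omega, cons (by simp) hj hp⟩
    · exact ⟨s, by omega, hp⟩

theorem wakeTime_le {F : Set V} {x y : V} {t : ℕ} (h : SimplePath ω F x y t) :
    wakeTime x ω y ≤ t := by
  induction h with
  | nil _ => simp [wakeTime_self]
  | cons _ hj _ ih =>
    push_cast
    exact (wakeTime_le_hitTime_add ω _ _ _ ih).trans (by gcongr; exact hj.hitTime_le)

end SimplePath

/-- Along some sequence of distinct sites outside `F`, beginning with `x`, the activity goes on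
for more than `n` units of time after the activation of `x`. -/
def LongChain (n : ℕ) (x : V) (F : Set V) : Set (Config V) :=
  {ω | (∃ i < ω.eta x, (n : ℕ∞) < ω.life x i) ∨
    ∃ k : Fin n, ∃ y : {y // y ∉ insert x F},
      Jump ω x y (k + 1) ∧ ω ∈ LongChain (n - (k + 1)) y (insert x F)}
termination_by n
decreasing_by omega

theorem SimplePath.mem_longChain {ω : Config V} (h0 : ∀ x i, ω.walk x i 0 = x)
    {F : Set V} {x y : V} {t : ℕ} (h : SimplePath ω F x y t) :
    ∀ {n : ℕ}, t ≤ n → (∃ i < ω.eta y, ((n - t : ℕ) : ℕ∞) < ω.life y i) →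
      ω ∈ LongChain n x F := by
  induction h with
  | nil hx =>
    intro n _ hn
    rw [LongChain]
    exact Or.inl (by simpa using hn)
  | @cons F x x' y k t hx hj hp ih =>
    intro n htn hn
    rw [LongChain]
    right
    have hx' := hp.notMem
    -- A jump of length zero ends where it began, which a path of distinct sites forbids. This is
    -- why `LongChain` uses lengths k + 1, and why its recursion on n terminates.
    obtain _ | k := k
    · obtain ⟨i, _, _, hw⟩ := hj
      exact absurd ((h0 x i).symm.trans hw) fun e => hx' (by simp [e])
    · exact ⟨⟨k, by omega⟩, ⟨x', hx'⟩, hj, ih (n := n - (k + 1)) (by omega)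
        (by rwa [show n - (k + 1) - t = n - (k + 1 + t) by omega])⟩

theorem ActiveAt.mem_longChain {ω : Config V} (h0 : ∀ x i, ω.walk x i 0 = x) {o x : V} {i n : ℕ}
    (h : ActiveAt o ω x i n) : ω ∈ LongChain n o ∅ := by
  obtain ⟨hi, hT, hn⟩ := h
  obtain ⟨t, ht⟩ : ∃ t : ℕ, wakeTime o ω x = t :=
    ⟨_, (ENat.natCast_toNat (ne_top_of_le_ne_top (by simp) hT)).symm⟩
  obtain ⟨m, γ, rfl, rfl, hs⟩ := exists_chain_of_wakeTime_le ht.le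
  obtain ⟨t', ht', hp⟩ := SimplePath.of_chain m γ t hs
  have h1 := hp.wakeTime_le
  rw [ht] at h1 hT hn
  have h2 : t ≤ t' := by exact_mod_cast h1
  -- Loop erasure cannot beat the infimum t, so the simple path takes exactly the wake time; the
  -- remaining life of the last particle can then be measured from it.
  obtain rfl : t = t' := by omega
  have htn : t ≤ n := by exact_mod_cast hT
  refine hp.mem_longChain h0 htn ⟨i, hi, ?_⟩
  generalize ω.life (γ (Fin.last m)) i = l at hn
  induction l using ENat.recTopCoe with
  | top => exact ENat.natCast_lt_top _
  | coe l =>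
    have : n < t + l := by exact_mod_cast hn
    exact_mod_cast (by omega : n - t < l)

end Chains

/-! ### First moment bound and extinction -/

section FirstMoment

set_option linter.unusedSectionVars false

variable {V : Type*} [MeasurableSpace V] [DiscreteMeasurableSpace V]

/-- The realizations at one site for which some particle belongs to `C`. -/
def someParticle (C : Set ((ℕ → V) × ℕ∞)) : Set (ℕ × (ℕ → (ℕ → V) × ℕ∞)) :=
  {s | ∃ i < s.1, s.2 i ∈ C}

theorem measurableSet_exists_particle {C : Set ((ℕ → V) × ℕ∞)} (hC : MeasurableSet C) :
    MeasurableSet (someParticle C) := by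
  have : someParticle C = ⋃ i, {s | i < s.1} ∩ {s | s.2 i ∈ C} := by
    ext; simp [someParticle]
  rw [this]
  refine MeasurableSet.iUnion fun i => MeasurableSet.inter ?_ ?_
  · exact measurable_fst (MeasurableSet.of_discrete (s := {n | i < n}))
  · exact ((measurable_pi_apply i).comp measurable_snd) hC

theorem measurableSet_alive_at (k : ℕ) {B : Set (ℕ → V)} (hB : MeasurableSet B) :
    MeasurableSet {c : (ℕ → V) × ℕ∞ | (k : ℕ∞) < c.2 ∧ c.1 ∈ B} :=
  (measurable_snd (MeasurableSet.of_discrete (s := {l | (k : ℕ∞) < l}))).inter (measurable_fst hB)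

theorem measurableSet_walk_eq (k : ℕ) (y : V) : MeasurableSet {w : ℕ → V | w k = y} :=
  measurable_pi_apply (X := fun _ : ℕ => V) k (MeasurableSet.singleton y)

variable [Countable V]

/-- Sites in F are never inspected. Applied with x added to F, this makes the continuation of a
chain independent of the jump from x. -/
theorem measurableSet_longChain (n : ℕ) : ∀ (x : V) (F : Set V), x ∉ F →
    MeasurableSet[siteSigma V Fᶜ] (LongChain n x F) := by
  induction n using Nat.strong_induction_on with
  | _ n ih =>
    intro x F hx
    rw [LongChain]
    simp only [Set.ofPred_or, Set.ofPred_exists, Set.ofPred_and]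
    refine MeasurableSet.union ?_ (MeasurableSet.iUnion fun k => MeasurableSet.iUnion fun y => ?_)
    · convert! measurableSet_siteSigma_preimage (S := Fᶜ) hx (measurableSet_exists_particle
        (measurableSet_alive_at n (MeasurableSet.univ (α := ℕ → V)))) using 1
      ext ω
      simp [Config.eta, Config.life, someParticle]
    · refine MeasurableSet.inter ?_ ?_
      · exact measurableSet_siteSigma_preimage (S := Fᶜ) hx (measurableSet_exists_particle
          (measurableSet_alive_at (k + 1) (measurableSet_walk_eq (k + 1) y.1)))
      · refine siteSigma_mono ?_ _ (ih (n - (k + 1)) (by omega) y (insert x F) y.2)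
        exact Set.compl_subset_compl.2 (Set.subset_insert x F)

variable (G : SimpleGraph V) [G.LocallyFinite] (ν : Measure ℕ) [IsProbabilityMeasure ν]
  (p : unitInterval)

theorem frogLaw_exists_particle_le (x : V) {C : Set ((ℕ → V) × ℕ∞)} (hC : MeasurableSet C) :
    frogLaw G ν p {ω | ω x ∈ someParticle C} ≤
      (∑' i, ν {n | i < n}) * particleLaw G p x C := by
  rw [← ENNReal.tsum_mul_right,
    frogLaw_site G ν p x (measurableSet_exists_particle hC)]
  have : someParticle C = ⋃ i, {s | i < s.1 ∧ s.2 i ∈ C} := by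
    ext; simp [someParticle]
  rw [this]
  exact (measure_iUnion_le _).trans_eq (tsum_congr fun i => siteLaw_particle G ν p x i hC)

theorem one_add_mul_geom_sum (m : ℝ≥0∞) (n : ℕ) :
    1 + m * ∑ k ∈ Finset.range n, (1 + m) ^ k = (1 + m) ^ n := by
  induction n with
  | zero => simp
  | succ n ih =>
    rw [Finset.sum_range_succ, mul_add, ← add_assoc, ih]
    ring

/-- Split according to the length k + 1 and target of the first jump, which is independent of the
continuation. Summing over targets costs nothing, as a walk occupies one site at a time, so the
powers of p combine to p^n. The identity 1 + m ∑_{k<n} (1+m)^k = (1+m)^n closes the induction. -/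
theorem frogLaw_longChain_le (hp : p ≠ 1) (n : ℕ) : ∀ (x : V) (F : Set V), x ∉ F →
    frogLaw G ν p (LongChain n x F) ≤ (∑' i, ν {n | i < n}) * ENNReal.ofReal p ^ n *
      (1 + ∑' i, ν {n | i < n}) ^ n := by
  set m := ∑' i, ν {n | i < n} with hm
  set q := ENNReal.ofReal p
  induction n using Nat.strong_induction_on with
  | _ n ih =>
    intro x F hx
    have hsub : LongChain n x F ⊆
        {ω | ω x ∈ someParticle {c : (ℕ → V) × ℕ∞ | (n : ℕ∞) < c.2 ∧ c.1 ∈ Set.univ}} ∪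
        ⋃ k : Fin n, ⋃ y : {y // y ∉ insert x F},
          {ω | ω x ∈ someParticle {c : (ℕ → V) × ℕ∞ | ((k + 1 : ℕ) : ℕ∞) < c.2 ∧
            c.1 ∈ {w | w (k + 1) = y.1}}} ∩ LongChain (n - (k + 1)) y (insert x F) := by
      intro ω hω
      rw [LongChain] at hω
      simp only [Set.mem_union, Set.mem_iUnion]
      rcases hω with h | ⟨k, y, h1, h2⟩
      · exact Or.inl (by simpa [someParticle, Config.eta, Config.life] using h)
      · exact Or.inr ⟨k, y, h1, h2⟩
    have h1 : frogLaw G ν p {ω | ω x ∈ someParticle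
        {c : (ℕ → V) × ℕ∞ | (n : ℕ∞) < c.2 ∧ c.1 ∈ Set.univ}} ≤ m * q ^ n := by
      refine (frogLaw_exists_particle_le G ν p x
        (measurableSet_alive_at n MeasurableSet.univ)).trans_eq ?_
      rw [particleLaw_alive G p hp, measure_univ, mul_one]
    have h2 : ∀ k : Fin n, frogLaw G ν p (⋃ y : {y // y ∉ insert x F},
          {ω | ω x ∈ someParticle {c : (ℕ → V) × ℕ∞ | ((k + 1 : ℕ) : ℕ∞) < c.2 ∧
            c.1 ∈ {w | w (k + 1) = y.1}}} ∩ LongChain (n - (k + 1)) y (insert x F)) ≤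
        m * q ^ n * (m * (1 + m) ^ (n - 1 - k)) := by
      intro k
      have hk : n - (k + 1) < n := by omega
      have hy : ∀ y : {y // y ∉ insert x F}, frogLaw G ν p
          ({ω | ω x ∈ someParticle {c : (ℕ → V) × ℕ∞ | ((k + 1 : ℕ) : ℕ∞) < c.2 ∧
            c.1 ∈ {w | w (k + 1) = y.1}}} ∩ LongChain (n - (k + 1)) y (insert x F)) ≤
          (m * q ^ (k + 1 : ℕ) * (m * q ^ (n - (k + 1)) * (1 + m) ^ (n - (k + 1)))) *
            srwLaw G x {w | w (k + 1) = y.1} := by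
        intro y
        have hC := measurableSet_alive_at (k + 1) (measurableSet_walk_eq (k + 1) y.1)
        rw [frogLaw_inter G ν p (S := {x}) (T := (insert x F)ᶜ) (by simp)
          (measurableSet_siteSigma_preimage (Set.mem_singleton x)
            (measurableSet_exists_particle hC))
          (measurableSet_longChain _ y.1 _ y.2)]
        refine (mul_le_mul' (frogLaw_exists_particle_le G ν p x hC) (ih _ hk y _ y.2)).trans_eq ?_
        rw [particleLaw_alive G p hp]
        ring
      refine (measure_iUnion_le _).trans ((ENNReal.tsum_le_tsum hy).trans ?_)
      rw [ENNReal.tsum_mul_left]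
      have hs : ∑' y : {y // y ∉ insert x F}, srwLaw G x {w | w (k + 1) = y.1} ≤ 1 := by
        rw [← measure_iUnion]
        · exact prob_le_one
        · intro y y' hyy
          refine Set.disjoint_left.2 fun w hw hw' => hyy (Subtype.ext ?_)
          have hw : w (k + 1) = y.1 := hw
          exact hw.symm.trans hw'
        · exact fun y => measurableSet_walk_eq _ _
      refine (mul_le_mul' le_rfl hs).trans_eq ?_
      have e1 : n - (k + 1) = n - 1 - k := by omega
      have e2 : q ^ n = q ^ (k + 1 : ℕ) * q ^ (n - (k + 1)) := by
        rw [← pow_add]; congr 1; omega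
      rw [e2, e1]
      ring
    calc frogLaw G ν p (LongChain n x F) ≤ m * q ^ n +
          ∑ k : Fin n, m * q ^ n * (m * (1 + m) ^ (n - 1 - k)) :=
          (measure_mono hsub).trans ((measure_union_le _ _).trans (add_le_add h1
            ((measure_iUnion_fintype_le _ _).trans (Finset.sum_le_sum fun k _ => h2 k))))
      _ = m * q ^ n * (1 + m * ∑ k ∈ Finset.range n, (1 + m) ^ k) := by
          rw [← Finset.mul_sum, ← Finset.mul_sum, mul_add, mul_one,
            Fin.sum_univ_eq_sum_range (fun k => (1 + m) ^ (n - 1 - k)) n,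
            Finset.sum_range_reflect (fun k => (1 + m) ^ k)]
      _ = m * q ^ n * (1 + m) ^ n := by rw [one_add_mul_geom_sum]

/-- If the mean number of active particles created per unit of time is below one, the frog model
dies out. -/
theorem frogLaw_survives_eq_zero (o : V) (hfin : ∑' i, ν {n | i < n} ≠ ∞)
    (hp : ENNReal.ofReal p * (1 + ∑' i, ν {n | i < n}) < 1) :
    frogLaw G ν p {ω | Survives o ω} = 0 := by
  set m := ∑' i, ν {n | i < n} with hm
  -- At p = 1 the product in `hp` is at least one.
  have hp1 : p ≠ 1 := by
    rintro rfl
    simp only [Set.Icc.coe_one, ENNReal.ofReal_one, one_mul] at hp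
    exact absurd hp (not_lt.2 le_self_add)
  have h0 : ∀ᵐ ω ∂frogLaw G ν p, ∀ x i, ω.walk x i 0 = x :=
    ae_particle G ν p (fun x w => w 0 = x) fun x =>
      (prob_compl_eq_zero_iff (measurableSet_walk_eq 0 x)).2 (srwLaw_zero G x)
  have hle : ∀ n : ℕ, frogLaw G ν p {ω | Survives o ω} ≤ m * (ENNReal.ofReal p * (1 + m)) ^ n := by
    intro n
    calc frogLaw G ν p {ω | Survives o ω} ≤ frogLaw G ν p (LongChain n o ∅) := by
          refine measure_mono_ae ?_
          filter_upwards [h0] with ω hω hs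
          obtain ⟨x, i, hx⟩ := hs n
          exact hx.mem_longChain hω
      _ ≤ _ := frogLaw_longChain_le G ν p hp1 n o ∅ (by simp)
      _ = _ := by rw [mul_pow]; ring
  have ht : Tendsto (fun n : ℕ => m * (ENNReal.ofReal p * (1 + m)) ^ n) atTop (𝓝 (m * 0)) :=
    ENNReal.Tendsto.const_mul (ENNReal.tendsto_pow_atTop_nhds_zero_of_lt_one hp) (Or.inr hfin)
  rw [mul_zero] at ht
  exact le_antisymm (ge_of_tendsto' ht hle) bot_le

end FirstMoment

/-! ### Straight spreading on the tree -/

section TreeGeometry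

variable {d : ℕ}

/-- The vertex reached from `y` after `k` steps towards the root. -/
def ancestor (y : TreeVertex d) (k : ℕ) : TreeVertex d := ⟨y.1.drop k, y.2.drop k⟩

theorem length_ancestor (y : TreeVertex d) (k : ℕ) :
    (ancestor y k).1.length = y.1.length - k := by
  simp [ancestor]

theorem ancestor_zero (y : TreeVertex d) : ancestor y 0 = y := by
  simp [ancestor]

theorem regTree_adj_ancestor (y : TreeVertex d) {k : ℕ} (hk : k < y.1.length) :
    (regTree d).Adj (ancestor y (k + 1)) (ancestor y k) :=
  ⟨y.1[k], Or.inr (List.drop_eq_getElem_cons hk)⟩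

theorem stepPMF_regTree (hd : 0 < d) (u v : TreeVertex d) :
    stepPMF (regTree d) u v = open Classical in if (regTree d).Adj u v then (d : ℝ≥0∞)⁻¹ else 0 := by
  have hcard : ((regTree d).neighborFinset u).card = d := regTree_isRegularOfDegree d u
  have hne : ((regTree d).neighborFinset u).Nonempty := Finset.card_pos.1 (by omega)
  rw [stepPMF, dif_pos hne, PMF.uniformOfFinset_apply, hcard]
  congr 1
  simp

theorem stepPMF_regTree_le (hd : 0 < d) (u v : TreeVertex d) :
    stepPMF (regTree d) u v ≤ (d : ℝ≥0∞)⁻¹ := by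
  rw [stepPMF_regTree hd]
  split_ifs <;> simp

theorem length_le_of_adj {u v : TreeVertex d} (h : (regTree d).Adj u v) :
    v.1.length ≤ u.1.length + 1 := by
  obtain ⟨a, h | h⟩ := h
  · rw [h]; simp only [List.length_cons]; omega
  · rw [h]; simp

theorem ae_length_walk_le (hd : 0 < d) (ν : Measure ℕ) [IsProbabilityMeasure ν]
    (p : unitInterval) : ∀ᵐ ω ∂frogLaw (regTree d) ν p, ∀ x i n,
      (ω.walk x i n).1.length ≤ x.1.length + n := by
  refine ae_particle (regTree d) ν p (fun x w => ∀ n, (w n).1.length ≤ x.1.length + n) fun x => ?_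
  have h0 : ∀ᵐ w ∂srwLaw (regTree d) x, w 0 = x :=
    (prob_compl_eq_zero_iff (measurableSet_walk_eq 0 x)).2 (srwLaw_zero _ x)
  have hstep : ∀ᵐ w ∂srwLaw (regTree d) x, ∀ n (u v : TreeVertex d), ¬ (regTree d).Adj u v →
      ¬ (w n = u ∧ w (n + 1) = v) := by
    simp only [ae_all_iff]
    intro n u v huv
    rw [ae_iff]
    simp only [not_not]
    exact srwLaw_nonadj _ x n u v (by rw [stepPMF_regTree hd, if_neg huv])
  filter_upwards [h0, hstep] with w hw0 hw n
  induction n with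
  | zero => simp [hw0]
  | succ n ih =>
    have hadj : (regTree d).Adj (w n) (w (n + 1)) := by
      by_contra h
      exact hw n _ _ h ⟨rfl, rfl⟩
    have := length_le_of_adj hadj
    omega

theorem SimplePath.length_le {ω : Config (TreeVertex d)}
    (hω : ∀ x i n, (ω.walk x i n).1.length ≤ x.1.length + n) {F : Set (TreeVertex d)}
    {x y : TreeVertex d} {t : ℕ} (h : SimplePath ω F x y t) : y.1.length ≤ x.1.length + t := by
  induction h with
  | nil _ => simp
  | @cons _ x _ _ k _ _ hj _ ih =>
    obtain ⟨i, _, _, rfl⟩ := hj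
    have := hω x i k
    omega

/-- Activity spreads at speed at most one. For sites reached by straight jumps the opposite
inequality also holds, so their wake times are known exactly. -/
theorem length_le_wakeTime {ω : Config (TreeVertex d)}
    (hω : ∀ x i n, (ω.walk x i n).1.length ≤ x.1.length + n) (x : TreeVertex d) :
    (x.1.length : ℕ∞) ≤ wakeTime (treeRoot d) ω x := by
  by_cases ht : wakeTime (treeRoot d) ω x = ⊤
  · simp [ht]
  lift wakeTime (treeRoot d) ω x to ℕ using ht with t ht'
  obtain ⟨m, γ, h0, rfl, hs⟩ := exists_chain_of_wakeTime_le ht'.symm.le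
  obtain ⟨t', ht', hp⟩ := SimplePath.of_chain m γ t hs
  have := hp.length_le hω
  rw [h0] at this
  simp only [treeRoot, List.length_nil] at this
  exact_mod_cast (by omega : _ ≤ t)

/-- The particles that follow the path from `ancestor y n` towards `y` for at least `k` steps. -/
def ray (y : TreeVertex d) (n k : ℕ) : Set ((ℕ → TreeVertex d) × ℕ∞) :=
  {c | (k : ℕ∞) < c.2 ∧ c.1 ∈ {w | ∀ l ≤ k, w l = ancestor y (n - l)}}

theorem ray_anti (y : TreeVertex d) (n : ℕ) {k k' : ℕ} (h : k ≤ k') : ray y n k' ⊆ ray y n k :=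
  fun _ hc => ⟨lt_of_le_of_lt (by exact_mod_cast h) hc.1, fun l hl => hc.2 l (hl.trans h)⟩

/-- One of the first `M` particles belongs to `C`. -/
def someParticleBelow {V : Type*} (M : ℕ) (C : Set ((ℕ → V) × ℕ∞)) :
    Set (ℕ × (ℕ → (ℕ → V) × ℕ∞)) :=
  ⋃ i ∈ Finset.range M, {s | i < s.1 ∧ s.2 i ∈ C}

theorem someParticleBelow_mono {V : Type*} (M : ℕ) {C C' : Set ((ℕ → V) × ℕ∞)} (h : C ⊆ C') :
    someParticleBelow M C ⊆ someParticleBelow M C' :=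
  Set.iUnion₂_mono fun _ _ _ hs => ⟨hs.1, h hs.2⟩

/-- Among the first `M` particles from `ancestor y n`, the furthest advance towards `y` is `k`. -/
def advance (M : ℕ) (y : TreeVertex d) (n k : ℕ) :
    Set (ℕ × (ℕ → (ℕ → TreeVertex d) × ℕ∞)) :=
  someParticleBelow M (ray y n k) \ someParticleBelow M (ray y n (k + 1))

theorem disjoint_advance (M : ℕ) (y : TreeVertex d) (n : ℕ) {k k' : ℕ} (h : k ≠ k') :
    Disjoint (advance M y n k) (advance M y n k') := by
  wlog hk : k < k' generalizing k k'
  · exact (this h.symm (by omega)).symm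
  refine Set.disjoint_left.2 fun s hs hs' => hs.2 ?_
  exact someParticleBelow_mono M (ray_anti y n hk) hs'.1

/-- The activity spreads from `ancestor y n` to `y` by particles that move directly
towards `y`, the furthest particle of a site always being taken. -/
def Reach (M : ℕ) (y : TreeVertex d) (n : ℕ) : Set (Config (TreeVertex d)) :=
  {ω | n = 0 ∨ ∃ k : Fin n, ω (ancestor y n) ∈ advance M y n (k + 1) ∧
    ω ∈ Reach M y (n - (k + 1))}
termination_by n
decreasing_by omega

/-- Each site used wakes exactly at its distance from the root, and the particle followed from it
stays alive until it wakes the next site. The activity intervals therefore cover all times up to the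
waking of y. -/
theorem Reach.wakeTime_le_and_active {M : ℕ} {y : TreeVertex d} {ω : Config (TreeVertex d)}
    (hω : ∀ x i n, (ω.walk x i n).1.length ≤ x.1.length + n) (n : ℕ) (hn : n ≤ y.1.length) :
    ω ∈ Reach M y n →
    wakeTime (treeRoot d) ω (ancestor y n) ≤ (y.1.length - n : ℕ) →
    wakeTime (treeRoot d) ω y ≤ y.1.length ∧
      ∀ τ, y.1.length - n ≤ τ → τ < y.1.length → ∃ x i, ActiveAt (treeRoot d) ω x i τ := by
  induction n using Nat.strong_induction_on with
  | _ n ih =>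
    intro hR hT
    rw [Reach] at hR
    rcases hR with rfl | ⟨k, hk, hR⟩
    · rw [ancestor_zero] at hT
      exact ⟨hT, fun τ h1 h2 => by omega⟩
    · obtain ⟨i, -, hi, hlife, hwalk⟩ : ∃ i, i ∈ Finset.range M ∧ i < (ω (ancestor y n)).1 ∧
          (ω (ancestor y n)).2 i ∈ ray y n (k + 1) := by
        have h := hk.1
        simp only [someParticleBelow, Set.mem_iUnion, exists_prop] at h
        exact h
      have hj : Jump ω (ancestor y n) (ancestor y (n - (k + 1))) (k + 1) :=
        ⟨i, hi, hlife, hwalk _ le_rfl⟩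
      have hT' : wakeTime (treeRoot d) ω (ancestor y (n - (k + 1))) ≤
          (y.1.length - (n - (k + 1)) : ℕ) := by
        refine (wakeTime_le_add_hitTime ω _ _ _ hT).trans
          ((add_le_add le_rfl hj.hitTime_le).trans ?_)
        exact_mod_cast (by omega : y.1.length - n + (k + 1) ≤ y.1.length - (n - (k + 1)))
      obtain ⟨h1, h2⟩ := ih _ (by omega) (by omega) hR hT'
      refine ⟨h1, fun τ hτ hτ' => ?_⟩
      by_cases hc : y.1.length - (n - (k + 1)) ≤ τ
      · exact h2 τ hc hτ'
      · refine ⟨ancestor y n, i, hi, hT.trans (by exact_mod_cast hτ), ?_⟩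
        have hlow := length_le_wakeTime hω (ancestor y n)
        rw [length_ancestor] at hlow
        have hl : ((k + 1 : ℕ) : ℕ∞) ≤ ω.life (ancestor y n) i := hlife.le
        refine lt_of_lt_of_le ?_ (add_le_add hlow hl)
        exact_mod_cast (by omega : τ < y.1.length - n + (k + 1))

/-- `y` is a descendant of `x` in generation `N`. -/
def IsDescendant (N : ℕ) (x y : TreeVertex d) : Prop :=
  ancestor y N = x ∧ y.1.length = x.1.length + N

/-- The activity of `x` spreads away from the root through `j` blocks of `N` generations. -/
def BlockSurvives (M N : ℕ) : ℕ → TreeVertex d → Set (Config (TreeVertex d))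
  | 0, _ => Set.univ
  | j + 1, x => ⋃ y, ⋃ (_ : IsDescendant N x y), Reach M y N ∩ BlockSurvives M N j y

theorem blockSurvives_succ_subset (M N j : ℕ) (x : TreeVertex d) :
    BlockSurvives M N (j + 1) x ⊆ BlockSurvives M N j x := by
  induction j generalizing x with
  | zero => exact Set.subset_univ _
  | succ j ih =>
    exact Set.iUnion₂_mono fun y _ => Set.inter_subset_inter_right _ (ih y)

theorem active_of_mem_blockSurvives {M N : ℕ} {ω : Config (TreeVertex d)}
    (hω : ∀ x i n, (ω.walk x i n).1.length ≤ x.1.length + n) (j : ℕ) :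
    ∀ x : TreeVertex d, wakeTime (treeRoot d) ω x ≤ x.1.length → ω ∈ BlockSurvives M N j x →
      ∀ τ, x.1.length ≤ τ → τ < x.1.length + j * N →
        ∃ x i, ActiveAt (treeRoot d) ω x i τ := by
  induction j with
  | zero => intro x _ _ τ h1 h2; omega
  | succ j ih =>
    intro x hx hs τ h1 h2
    simp only [BlockSurvives, Set.mem_iUnion, Set.mem_inter_iff, exists_prop] at hs
    obtain ⟨y, ⟨rfl, hy⟩, hR, hB⟩ := hs
    rw [length_ancestor] at h1 h2 hx hy
    obtain ⟨ha, hb⟩ := Reach.wakeTime_le_and_active hω N (by omega) hR hx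
    by_cases hc : τ < y.1.length
    · exact hb τ h1 hc
    · exact ih y ha hB τ (by omega) (by rw [add_mul] at h2; omega)

theorem survives_of_forall_blockSurvives {M N : ℕ} (hN : 0 < N) {ω : Config (TreeVertex d)}
    (hω : ∀ x i n, (ω.walk x i n).1.length ≤ x.1.length + n)
    (h : ∀ j, ω ∈ BlockSurvives M N j (treeRoot d)) : Survives (treeRoot d) ω := fun n =>
  active_of_mem_blockSurvives hω (n + 1) (treeRoot d) (by simp [wakeTime_self]) (h (n + 1)) n
    (by simp [treeRoot]) (by
      simp only [treeRoot, List.length_nil]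
      nlinarith)

/-- A neighbour of `x` further away from the root, for each of `e` indices. -/
def child {e : ℕ} (x : TreeVertex (e + 1)) (a : Fin e) : TreeVertex (e + 1) :=
  match x with
  | ⟨[], _⟩ => ⟨[a.castSucc], by simp⟩
  | ⟨b :: l, h⟩ => ⟨b.succAbove a :: b :: l, by simp [Fin.succAbove_ne, h]⟩

theorem child_tail {e : ℕ} (x : TreeVertex (e + 1)) (a : Fin e) :
    ∃ b, (child x a).1 = b :: x.1 := by
  obtain ⟨_ | ⟨b, l⟩, h⟩ := x
  · exact ⟨a.castSucc, rfl⟩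
  · exact ⟨b.succAbove a, rfl⟩

theorem child_injective {e : ℕ} :
    Function.Injective fun c : TreeVertex (e + 1) × Fin e => child c.1 c.2 := by
  rintro ⟨x, a⟩ ⟨x', a'⟩ h
  simp only at h
  obtain ⟨b, hb⟩ := child_tail x a
  obtain ⟨b', hb'⟩ := child_tail x' a'
  have h1 : x = x' := by
    rw [h, hb'] at hb
    exact Subtype.ext (List.cons.inj hb).2.symm
  subst h1
  obtain ⟨_ | ⟨b, l⟩, hx⟩ := x
  · simpa [child] using h
  · simpa [child] using h

/-- One child of the root is left out, so that every vertex has e = d - 1 children and the count is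
the same everywhere. -/
theorem exists_descendants {e : ℕ} (N : ℕ) (x : TreeVertex (e + 1)) :
    ∃ D : Finset (TreeVertex (e + 1)), D.card = e ^ N ∧ ∀ y ∈ D, IsDescendant N x y := by
  induction N with
  | zero => exact ⟨{x}, by simp, by simp [IsDescendant, ancestor_zero]⟩
  | succ N ih =>
    obtain ⟨D, hD, hx⟩ := ih
    refine ⟨(D ×ˢ (Finset.univ : Finset (Fin e))).map ⟨_, child_injective⟩, ?_, ?_⟩
    · simp [hD, pow_succ]
    · intro y hy
      simp only [Finset.mem_map, Finset.mem_product, Finset.mem_univ, and_true,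
        Function.Embedding.coeFn_mk, Prod.exists] at hy
      obtain ⟨z, a, hz, rfl⟩ := hy
      obtain ⟨h1, h2⟩ := hx z hz
      obtain ⟨b, hb⟩ := child_tail z a
      refine ⟨?_, ?_⟩
      · rw [← h1]
        exact Subtype.ext (by simp [ancestor, hb])
      · rw [hb, List.length_cons, h2]; ring

/-- The vertices at or behind `x`, seen from the root. -/
def cone (x : TreeVertex d) : Set (TreeVertex d) := {v | x.1 <:+ v.1}

theorem disjoint_cone {x y : TreeVertex d} (hl : x.1.length = y.1.length) (h : x ≠ y) :
    Disjoint (cone x) (cone y) := by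
  refine Set.disjoint_left.2 fun v hx hy => h (Subtype.ext ?_)
  exact (List.suffix_of_suffix_length_le hx hy hl.le).eq_of_length hl

theorem IsDescendant.cone_subset {N : ℕ} {x y : TreeVertex d} (h : IsDescendant N x y) :
    cone y ⊆ cone x := by
  intro v hv
  obtain ⟨rfl, -⟩ := h
  exact (List.drop_suffix N y.1).trans hv

/-- The sites between `ancestor y n` and `y`, without `y`. -/
def segment (y : TreeVertex d) (n : ℕ) : Set (TreeVertex d) :=
  {v | ∃ l, 1 ≤ l ∧ l ≤ n ∧ v = ancestor y l}

theorem IsDescendant.segment_subset {N : ℕ} {x y : TreeVertex d} (h : IsDescendant N x y) :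
    segment y N ⊆ cone x := by
  rintro v ⟨l, h1, h2, rfl⟩
  obtain ⟨rfl, -⟩ := h
  exact List.drop_suffix_drop_left y.1 h2

/-- Reaching y does not involve the particles of y itself; leaving y out of the segment makes this
event independent of the spread behind y. -/
theorem disjoint_segment_cone (y : TreeVertex d) {n : ℕ} (hn : n ≤ y.1.length) :
    Disjoint (segment y n) (cone y) := by
  refine Set.disjoint_left.2 ?_
  rintro v ⟨l, h1, h2, rfl⟩ hv
  have : y.1.length ≤ (ancestor y l).1.length := List.IsSuffix.length_le hv
  rw [length_ancestor] at this
  omega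

end TreeGeometry

/-! ### Second order inclusion–exclusion with weights -/

section Bonferroni

/-- Ordered pairs are subtracted, so every pair counts twice. With S the sum of the a i, and the sum
of their squares at most S, the left side is at most 2S - S² = 1 - (S-1)². -/
theorem sum_sub_sum_mul_le_one {ι : Type*} [DecidableEq ι] (s : Finset ι) (a : ι → ℝ)
    (h0 : ∀ i ∈ s, 0 ≤ a i) (h1 : ∀ i ∈ s, a i ≤ 1) :
    ∑ i ∈ s, a i - ∑ i ∈ s, ∑ j ∈ s.erase i, a i * a j ≤ 1 := by
  have e : ∀ i ∈ s, ∑ j ∈ s.erase i, a i * a j = a i * (∑ j ∈ s, a j) - a i * a i := by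
    intro i hi
    rw [← Finset.mul_sum, ← Finset.add_sum_erase s a hi]
    ring
  rw [Finset.sum_congr rfl e, Finset.sum_sub_distrib, ← Finset.sum_mul]
  set S := ∑ i ∈ s, a i
  have hsq : ∑ i ∈ s, a i * a i ≤ S :=
    Finset.sum_le_sum fun i hi => by nlinarith [h0 i hi, h1 i hi]
  nlinarith [sq_nonneg (S - 1)]

/-- A weighted Bonferroni inequality. -/
theorem measureReal_biUnion_ge {Ω ι : Type*} [MeasurableSpace Ω] (μ : Measure Ω)
    [IsProbabilityMeasure μ] (s : Finset ι) (A : ι → Set Ω) (hA : ∀ i ∈ s, MeasurableSet (A i))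
    (w : ι → ℝ) (h0 : ∀ i ∈ s, 0 ≤ w i) (h1 : ∀ i ∈ s, w i ≤ 1) (a : ι → ℝ) (b : ℝ)
    (hb : 0 ≤ b) (ha : ∀ i ∈ s, a i ≤ w i * μ.real (A i))
    (hab : ∀ i ∈ s, ∀ j ∈ s, i ≠ j → w i * w j * μ.real (A i ∩ A j) ≤ b) :
    ∑ i ∈ s, a i - (s.card : ℝ) ^ 2 * b ≤ μ.real (⋃ i ∈ s, A i) := by
  classical
  have hU : MeasurableSet (⋃ i ∈ s, A i) := Finset.measurableSet_biUnion s hA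
  have hint : ∀ (C : Set Ω) (c : ℝ), MeasurableSet C →
      Integrable (C.indicator fun _ => c) μ := fun C c hC => (integrable_const c).indicator hC
  have hpt : ∀ ω, ∑ i ∈ s, (A i).indicator (fun _ => w i) ω -
      ∑ i ∈ s, ∑ j ∈ s.erase i, (A i ∩ A j).indicator (fun _ => w i * w j) ω ≤
      (⋃ i ∈ s, A i).indicator (fun _ => (1 : ℝ)) ω := by
    intro ω
    by_cases hω : ω ∈ ⋃ i ∈ s, A i
    · rw [Set.indicator_of_mem hω]
      refine le_of_eq_of_le ?_ (sum_sub_sum_mul_le_one s (fun i => (A i).indicator (fun _ => w i) ω)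
        (fun i hi => Set.indicator_nonneg (fun _ _ => h0 i hi) ω)
        (fun i hi => Set.indicator_le' (f := fun _ => w i) (g := fun _ => 1) (fun _ _ => h1 i hi)
          (fun _ _ => zero_le_one) ω))
      congr 1
      refine Finset.sum_congr rfl fun i _ => Finset.sum_congr rfl fun j _ => ?_
      exact Set.inter_indicator_mul (fun _ => w i) (fun _ => w j) ω
    · rw [Set.indicator_of_notMem hω]
      have hn : ∀ i ∈ s, ω ∉ A i := fun i hi h => hω (Set.mem_biUnion hi h)
      rw [Finset.sum_eq_zero fun i hi => Set.indicator_of_notMem (hn i hi) _,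
        Finset.sum_eq_zero fun i hi => Finset.sum_eq_zero fun j _ =>
          Set.indicator_of_notMem (fun h => hn i hi h.1) _]
      simp
  have hI1 : Integrable (fun ω => ∑ i ∈ s, (A i).indicator (fun _ => w i) ω) μ :=
    integrable_finsetSum _ fun i hi => hint _ _ (hA i hi)
  have hI2 : Integrable (fun ω => ∑ i ∈ s, ∑ j ∈ s.erase i,
      (A i ∩ A j).indicator (fun _ => w i * w j) ω) μ :=
    integrable_finsetSum _ fun i hi => integrable_finsetSum _ fun j hj =>
      hint _ _ ((hA i hi).inter (hA j (Finset.mem_of_mem_erase hj)))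
  have hmono := integral_mono (hI1.sub hI2) (hint _ 1 hU) hpt
  simp only [Pi.sub_apply] at hmono
  rw [integral_sub hI1 hI2, integral_finsetSum _ fun i hi => hint _ _ (hA i hi),
    integral_finsetSum _ fun i hi => integrable_finsetSum _ fun j hj =>
      hint _ _ ((hA i hi).inter (hA j (Finset.mem_of_mem_erase hj))),
    integral_indicator_const _ hU] at hmono
  have e1 : ∑ i ∈ s, a i ≤ ∑ i ∈ s, ∫ ω, (A i).indicator (fun _ => w i) ω ∂μ :=
    Finset.sum_le_sum fun i hi => by
      rw [integral_indicator_const _ (hA i hi), smul_eq_mul, mul_comm]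
      exact ha i hi
  have e2 : ∑ i ∈ s, ∫ ω, ∑ j ∈ s.erase i, (A i ∩ A j).indicator (fun _ => w i * w j) ω ∂μ ≤
      (s.card : ℝ) ^ 2 * b := by
    have : ∀ i ∈ s, ∫ ω, ∑ j ∈ s.erase i, (A i ∩ A j).indicator (fun _ => w i * w j) ω ∂μ ≤
        s.card * b := by
      intro i hi
      rw [integral_finsetSum _ fun j hj =>
        hint _ _ ((hA i hi).inter (hA j (Finset.mem_of_mem_erase hj)))]
      calc _ ≤ ∑ j ∈ s.erase i, b := Finset.sum_le_sum fun j hj => by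
            have hj' := Finset.mem_erase.1 hj
            rw [integral_indicator_const _ ((hA i hi).inter (hA j hj'.2)), smul_eq_mul, mul_comm]
            exact hab i hi j hj'.2 hj'.1.symm
        _ ≤ s.card * b := by
            rw [Finset.sum_const, nsmul_eq_mul]
            gcongr
            exact Finset.erase_subset i s
    refine (Finset.sum_le_sum this).trans_eq ?_
    rw [Finset.sum_const, nsmul_eq_mul]
    ring
  simp only [smul_eq_mul, mul_one] at hmono
  linarith

end Bonferroni

/-! ### One site: some particle among the first M -/

section Advance

variable {V : Type*} [MeasurableSpace V]

theorem measurableSet_particle (i : ℕ) {C : Set ((ℕ → V) × ℕ∞)} (hC : MeasurableSet C) :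
    MeasurableSet {s : ℕ × (ℕ → (ℕ → V) × ℕ∞) | i < s.1 ∧ s.2 i ∈ C} :=
  (measurable_fst (MeasurableSet.of_discrete (s := {n | i < n}))).inter
    (((measurable_pi_apply i).comp measurable_snd) hC)

theorem measurableSet_someParticleBelow (M : ℕ) {C : Set ((ℕ → V) × ℕ∞)} (hC : MeasurableSet C) :
    MeasurableSet (someParticleBelow M C) :=
  Finset.measurableSet_biUnion _ fun i _ => measurableSet_particle i hC

variable [DiscreteMeasurableSpace V] (G : SimpleGraph V) [G.LocallyFinite] (ν : Measure ℕ)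
  [IsProbabilityMeasure ν] (p : unitInterval)

theorem siteLaw_real_particle (x : V) (i : ℕ) {C : Set ((ℕ → V) × ℕ∞)} (hC : MeasurableSet C) :
    (siteLaw G ν p x).real {s | i < s.1 ∧ s.2 i ∈ C} =
      ν.real {n | i < n} * (particleLaw G p x).real C := by
  rw [measureReal_def, siteLaw_particle G ν p x i hC, ENNReal.toReal_mul]
  rfl

theorem siteLaw_someParticleBelow_le (x : V) (M : ℕ) {C : Set ((ℕ → V) × ℕ∞)}
    (hC : MeasurableSet C) :
    (siteLaw G ν p x).real (someParticleBelow M C) ≤ M * (particleLaw G p x).real C := by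
  refine (measureReal_biUnion_finset_le _ _).trans ?_
  calc _ ≤ ∑ i ∈ Finset.range M, (particleLaw G p x).real C :=
        Finset.sum_le_sum fun i _ => by
          rw [siteLaw_real_particle G ν p x i hC]
          exact mul_le_of_le_one_left measureReal_nonneg measureReal_le_one
    _ = _ := by simp

/-- Bonferroni with unit weights. The truncation at M bounds the pair term without a second moment
of η. -/
theorem le_siteLaw_someParticleBelow (x : V) (M : ℕ) {C : Set ((ℕ → V) × ℕ∞)}
    (hC : MeasurableSet C) :
    (∑ i ∈ Finset.range M, ν.real {n | i < n}) * (particleLaw G p x).real C -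
      (M : ℝ) ^ 2 * (particleLaw G p x).real C ^ 2 ≤
      (siteLaw G ν p x).real (someParticleBelow M C) := by
  have := measureReal_biUnion_ge (siteLaw G ν p x) (Finset.range M)
    (fun i => {s | i < s.1 ∧ s.2 i ∈ C}) (fun i _ => measurableSet_particle i hC)
    (fun _ => 1) (by simp) (by simp) (fun i => ν.real {n | i < n} * (particleLaw G p x).real C)
    ((particleLaw G p x).real C ^ 2) (by positivity)
    (fun i _ => by rw [one_mul, siteLaw_real_particle G ν p x i hC])
    (fun i _ j _ hij => by
      rw [one_mul, one_mul, measureReal_def, measureReal_def, ← ENNReal.toReal_pow]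
      refine ENNReal.toReal_mono (by finiteness) ?_
      refine le_trans (measure_mono ?_) (siteLaw_pair_le G ν p x hij hC)
      exact fun s hs => ⟨hs.1.2, hs.2.2⟩)
  rw [Finset.card_range, ← Finset.sum_mul] at this
  exact this

theorem le_siteLaw_diff (x : V) (M : ℕ) {C C' : Set ((ℕ → V) × ℕ∞)}
    (hC : MeasurableSet C) (hC' : MeasurableSet C') :
    (∑ i ∈ Finset.range M, ν.real {n | i < n}) * (particleLaw G p x).real C -
      (M : ℝ) ^ 2 * (particleLaw G p x).real C ^ 2 - M * (particleLaw G p x).real C' ≤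
      (siteLaw G ν p x).real (someParticleBelow M C \ someParticleBelow M C') := by
  have h1 := le_siteLaw_someParticleBelow G ν p x M hC
  have h2 := siteLaw_someParticleBelow_le G ν p x M hC'
  have h3 := le_measureReal_sdiff (μ := siteLaw G ν p x) (s₁ := someParticleBelow M C)
    (s₂ := someParticleBelow M C')
  linarith

end Advance

/-! ### Probability estimates on the tree and block branching -/

section TreeEstimates

variable {d : ℕ}

theorem measurableSet_ray (y : TreeVertex d) (n k : ℕ) : MeasurableSet (ray y n k) := by
  refine measurableSet_alive_at k ?_
  simp only [Set.ofPred_forall]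
  exact MeasurableSet.iInter fun l => MeasurableSet.iInter fun _ => measurableSet_walk_eq l _

theorem measurableSet_advance (M : ℕ) (y : TreeVertex d) (n k : ℕ) :
    MeasurableSet (advance M y n k) :=
  (measurableSet_someParticleBelow M (measurableSet_ray y n k)).diff
    (measurableSet_someParticleBelow M (measurableSet_ray y n (k + 1)))

theorem srwLaw_path_zero (y : TreeVertex d) (n : ℕ) :
    srwLaw (regTree d) (ancestor y n) {w | ∀ l ≤ 0, w l = ancestor y (n - l)} = 1 := by
  simpa using srwLaw_zero (regTree d) (ancestor y n)

theorem srwLaw_path_le (hd : 0 < d) (y : TreeVertex d) (n k : ℕ) :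
    srwLaw (regTree d) (ancestor y n) {w | ∀ l ≤ k, w l = ancestor y (n - l)} ≤
      ((d : ℝ≥0∞)⁻¹) ^ k := by
  induction k with
  | zero => rw [srwLaw_path_zero]; simp
  | succ k ih =>
    rw [srwLaw_path_succ (regTree d) (ancestor y n) (fun l => ancestor y (n - l)), pow_succ]
    exact mul_le_mul' ih (stepPMF_regTree_le hd _ _)

theorem srwLaw_path (hd : 0 < d) (y : TreeVertex d) {n k : ℕ} (hk : k ≤ n)
    (hn : n ≤ y.1.length) :
    srwLaw (regTree d) (ancestor y n) {w | ∀ l ≤ k, w l = ancestor y (n - l)} =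
      ((d : ℝ≥0∞)⁻¹) ^ k := by
  induction k with
  | zero => rw [srwLaw_path_zero]; simp
  | succ k ih =>
    rw [srwLaw_path_succ (regTree d) (ancestor y n) (fun l => ancestor y (n - l)), pow_succ,
      ih (by omega), stepPMF_regTree hd, if_pos]
    have := regTree_adj_ancestor y (k := n - (k + 1)) (by omega)
    rwa [show n - (k + 1) + 1 = n - k by omega] at this

variable (ν : Measure ℕ) [IsProbabilityMeasure ν] (p : unitInterval)

/-- No relation between k and n is assumed. For k > n the truncated subtraction prescribes a rest at
y; the one-step bound still applies, and this case occurs when an advance ends exactly at y. -/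
theorem particleLaw_ray_le (hd : 0 < d) (hp : p ≠ 1) (y : TreeVertex d) (n k : ℕ) :
    (particleLaw (regTree d) p (ancestor y n)).real (ray y n k) ≤ ((p : ℝ) / d) ^ k := by
  have h : particleLaw (regTree d) p (ancestor y n) (ray y n k) ≤
      ENNReal.ofReal p ^ k * ((d : ℝ≥0∞)⁻¹) ^ k := by
    rw [ray, particleLaw_alive _ p hp]
    exact mul_le_mul' le_rfl (srwLaw_path_le hd y n k)
  have hd' : (d : ℝ≥0∞)⁻¹ ≠ ∞ := by simp; omega
  have := ENNReal.toReal_mono (by finiteness) h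
  rw [measureReal_def]
  refine this.trans_eq ?_
  simp [ENNReal.toReal_ofReal p.2.1, div_eq_mul_inv, mul_pow]

theorem particleLaw_ray (hd : 0 < d) (hp : p ≠ 1) (y : TreeVertex d) {n k : ℕ} (hk : k ≤ n)
    (hn : n ≤ y.1.length) :
    (particleLaw (regTree d) p (ancestor y n)).real (ray y n k) = ((p : ℝ) / d) ^ k := by
  rw [measureReal_def, ray, particleLaw_alive _ p hp, srwLaw_path hd y hk hn]
  simp [ENNReal.toReal_ofReal p.2.1, div_eq_mul_inv, mul_pow]

/-- A lower bound for the effective mean number of particles, after truncation at `M` and in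
degree `d`. -/
def effectiveMean (ν : Measure ℕ) (p : unitInterval) (M d : ℕ) : ℝ :=
  ∑ i ∈ Finset.range M, ν.real {n | i < n} - ((M : ℝ) ^ 2 + M) * ((p : ℝ) / d)

/-- The two losses, pairs of particles and particles going one step further, are each smaller than
the main term by a factor p/d. Together they form the correction in `effectiveMean`. -/
theorem le_siteLaw_advance (hd : 0 < d) (hp : p ≠ 1) (M : ℕ) (y : TreeVertex d) {n k : ℕ}
    (hk : k + 1 ≤ n) (hn : n ≤ y.1.length) :
    effectiveMean ν p M d * ((p : ℝ) / d) ^ (k + 1) ≤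
      (siteLaw (regTree d) ν p (ancestor y n)).real (advance M y n (k + 1)) := by
  have h := le_siteLaw_diff (regTree d) ν p (ancestor y n) M (measurableSet_ray y n (k + 1))
    (measurableSet_ray y n (k + 1 + 1))
  refine le_trans ?_ h
  have h1 := particleLaw_ray p hd hp y hk hn
  have h2 := particleLaw_ray_le p hd hp y n (k + 1 + 1)
  rw [h1, effectiveMean]
  set α := (p : ℝ) / d
  have hα0 : 0 ≤ α := div_nonneg p.2.1 (by positivity)
  have hα1 : α ≤ 1 := by
    refine div_le_one_of_le₀ (p.2.2.trans ?_) (by positivity)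
    exact_mod_cast hd
  have hsq : (α ^ (k + 1)) ^ 2 ≤ α * α ^ (k + 1) := by
    have : α ^ (k + 1) ≤ α := pow_le_of_le_one hα0 hα1 (by omega)
    have h0 : 0 ≤ α ^ (k + 1) := by positivity
    nlinarith
  have e : α ^ (k + 1 + 1) = α * α ^ (k + 1) := by ring
  rw [e] at h2
  have hM1 : (M : ℝ) ^ 2 * (α ^ (k + 1)) ^ 2 ≤ (M : ℝ) ^ 2 * (α * α ^ (k + 1)) := by gcongr
  have hM2 := mul_le_mul_of_nonneg_left h2 (Nat.cast_nonneg (α := ℝ) M)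
  linarith

theorem measurableSet_reach (M : ℕ) (y : TreeVertex d) (n : ℕ) :
    MeasurableSet[siteSigma (TreeVertex d) (segment y n)] (Reach M y n) := by
  induction n using Nat.strong_induction_on with
  | _ n ih =>
    rw [Reach]
    simp only [Set.ofPred_or, Set.ofPred_exists, Set.ofPred_and]
    refine MeasurableSet.union ?_ (MeasurableSet.iUnion fun k => MeasurableSet.inter ?_ ?_)
    · exact MeasurableSet.const _
    · exact measurableSet_siteSigma_preimage (x := ancestor y n)
        (show ancestor y n ∈ segment y n from ⟨n, Fin.pos k, le_rfl, rfl⟩) (measurableSet_advance M y n (k + 1))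
    · refine siteSigma_mono ?_ _ (ih _ (by omega))
      rintro v ⟨l, h1, h2, rfl⟩
      exact ⟨l, h1, by omega, rfl⟩

/-- The coefficients of the renewal equation `b n = c * ∑ i < n, b i`, `b 0 = 1`. -/
def renewal (c : ℝ) (n : ℕ) : ℝ := if n = 0 then 1 else c * (1 + c) ^ (n - 1)

theorem sum_renewal (c : ℝ) (n : ℕ) :
    ∑ i ∈ Finset.range (n + 1), renewal c i = (1 + c) ^ n := by
  induction n with
  | zero => simp [renewal]
  | succ n ih =>
    rw [Finset.sum_range_succ, ih, renewal, if_neg (by omega), Nat.add_sub_cancel]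
    ring

theorem frogLaw_real_inter {S T : Set (TreeVertex d)} (hST : Disjoint S T)
    {A B : Set (Config (TreeVertex d))}
    (hA : MeasurableSet[siteSigma (TreeVertex d) S] A)
    (hB : MeasurableSet[siteSigma (TreeVertex d) T] B) :
    (frogLaw (regTree d) ν p).real (A ∩ B) =
      (frogLaw (regTree d) ν p).real A * (frogLaw (regTree d) ν p).real B := by
  rw [measureReal_def, frogLaw_inter _ ν p hST hA hB, ENNReal.toReal_mul]
  rfl

/-- Different furthest advances are disjoint, so the probability is an exact sum over the first
jump. The jump depends on one site and the continuation only on sites nearer to y, hence each term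
factors and the renewal recursion appears. -/
theorem le_frogLaw_reach (hd : 0 < d) (hp : p ≠ 1) (M : ℕ) (y : TreeVertex d)
    (hc : 0 ≤ effectiveMean ν p M d) (n : ℕ) (hn : n ≤ y.1.length) :
    renewal (effectiveMean ν p M d) n * ((p : ℝ) / d) ^ n ≤
      (frogLaw (regTree d) ν p).real (Reach M y n) := by
  set c := effectiveMean ν p M d with hcdef
  set α := (p : ℝ) / d with hα
  have hα0 : 0 ≤ α := div_nonneg p.2.1 (by positivity)
  induction n using Nat.strong_induction_on with
  | _ n ih =>
    rcases Nat.eq_zero_or_pos n with rfl | hpos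
    · rw [Reach]
      simp [renewal]
    obtain ⟨n, rfl⟩ : ∃ m, n = m + 1 := ⟨n - 1, by omega⟩
    have hsub : Reach M y (n + 1) = ⋃ k : Fin (n + 1),
        {ω | ω (ancestor y (n + 1)) ∈ advance M y (n + 1) (k + 1)} ∩
          Reach M y (n + 1 - (k + 1)) := by
      ext ω
      rw [Reach]
      simp
    have hmeas : ∀ k : Fin (n + 1), MeasurableSet[siteSigma (TreeVertex d) {ancestor y (n + 1)}]
        {ω : Config (TreeVertex d) | ω (ancestor y (n + 1)) ∈ advance M y (n + 1) (k + 1)} :=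
      fun k => measurableSet_siteSigma_preimage (Set.mem_singleton _) (measurableSet_advance _ _ _ _)
    have hdisj : ∀ k : Fin (n + 1),
        Disjoint {ancestor y (n + 1)} (segment y (n + 1 - (k + 1))) := by
      intro k
      rw [Set.disjoint_singleton_left]
      rintro ⟨l, h1, h2, h3⟩
      have := congrArg (fun v => v.1.length) h3
      simp only [length_ancestor] at this
      omega
    rw [hsub, measureReal_iUnion_fintype]
    · calc renewal c (n + 1) * α ^ (n + 1)
          = ∑ k : Fin (n + 1), (c * α ^ (k + 1 : ℕ)) *
              (renewal c (n + 1 - (k + 1)) * α ^ (n + 1 - (k + 1 : ℕ))) := by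
            have : ∀ k : Fin (n + 1), (c * α ^ (k + 1 : ℕ)) *
                (renewal c (n + 1 - (k + 1)) * α ^ (n + 1 - (k + 1 : ℕ))) =
                c * α ^ (n + 1) * renewal c (n + 1 - 1 - k) := by
              intro k
              have e1 : n + 1 - (k + 1 : ℕ) = n + 1 - 1 - k := by omega
              have e2 : α ^ (n + 1) = α ^ (k + 1 : ℕ) * α ^ (n + 1 - 1 - k : ℕ) := by
                rw [← pow_add]; congr 1; omega
              rw [e1, e2]; ring
            rw [Finset.sum_congr rfl fun k _ => this k, ← Finset.mul_sum,
              Fin.sum_univ_eq_sum_range (fun k => renewal c (n + 1 - 1 - k)) (n + 1),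
              Finset.sum_range_reflect (fun k => renewal c k), sum_renewal, renewal,
              if_neg (by omega), Nat.add_sub_cancel]
            ring
        _ ≤ _ := Finset.sum_le_sum fun k _ => by
            rw [frogLaw_real_inter ν p (hdisj k) (hmeas k) (measurableSet_reach M y _)]
            refine mul_le_mul ?_ (ih _ (by omega) (by omega)) ?_ measureReal_nonneg
            · rw [measureReal_def, frogLaw_site _ ν p _ (measurableSet_advance _ _ _ _)]
              exact le_siteLaw_advance ν p hd hp M y (by omega) hn
            · rw [renewal]
              split_ifs <;> positivity
    · intro k k' hkk
      refine Set.disjoint_left.2 fun ω h h' => ?_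
      refine Set.disjoint_left.1 (disjoint_advance M y (n + 1) (k := k + 1) (k' := k' + 1) ?_)
        h.1 h'.1
      simpa [Fin.ext_iff] using hkk
    · exact fun k => (siteSigma_le _ _ (hmeas k)).inter (siteSigma_le _ _ (measurableSet_reach M y _))

theorem measurableSet_blockSurvives (M N j : ℕ) : ∀ x : TreeVertex d,
    MeasurableSet[siteSigma (TreeVertex d) (cone x)] (BlockSurvives M N j x) := by
  induction j with
  | zero => exact fun x => MeasurableSet.univ
  | succ j ih =>
    refine fun x => MeasurableSet.iUnion fun y => MeasurableSet.iUnion fun hy => ?_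
    exact (siteSigma_mono hy.segment_subset _ (measurableSet_reach M y N)).inter
      (siteSigma_mono hy.cone_subset _ (ih y))

/-- With L = e^N descendants, each reached with probability at least r, a second moment bound turns
a lower bound s for j blocks into L r s - L² s² for j + 1 blocks. The stated s is the positive fixed
point, so the bound does not decay with j. -/
theorem le_frogLaw_blockSurvives {e : ℕ} (M N : ℕ) (r : ℝ)
    (hr : ∀ y : TreeVertex (e + 1), N ≤ y.1.length →
      r ≤ (frogLaw (regTree (e + 1)) ν p).real (Reach M y N))
    (hL : 1 < (e : ℝ) ^ N * r) (j : ℕ) : ∀ x : TreeVertex (e + 1),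
    ((e : ℝ) ^ N * r - 1) / ((e : ℝ) ^ N) ^ 2 ≤
      (frogLaw (regTree (e + 1)) ν p).real (BlockSurvives M N j x) := by
  set L := (e : ℝ) ^ N with hLdef
  set s := (L * r - 1) / L ^ 2 with hs
  set P := frogLaw (regTree (e + 1)) ν p
  have hL0 : 0 < L := lt_of_le_of_ne (by positivity) fun h => by
    rw [← h] at hL; norm_num at hL
  have hs0 : 0 < s := div_pos (by linarith) (by positivity)
  induction j with
  | zero =>
    intro x
    obtain ⟨D, hD, hx⟩ := exists_descendants N x
    have hL1 : 1 ≤ L := by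
      have : 0 < e ^ N := by
        have : (0 : ℝ) < (e ^ N : ℕ) := by push_cast; exact hL0
        exact_mod_cast this
      rw [hLdef]
      exact_mod_cast this
    obtain ⟨y, hy⟩ : D.Nonempty := by
      rw [← Finset.card_pos, hD]
      have : (0 : ℝ) < (e ^ N : ℕ) := by push_cast; exact hL0
      exact_mod_cast this
    have hr1 : r ≤ 1 := (hr y (by rw [(hx y hy).2]; omega)).trans measureReal_le_one
    have : s ≤ 1 := by
      rw [hs, div_le_one (by positivity)]
      nlinarith
    simpa [BlockSurvives] using this
  | succ j ih =>
    intro x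
    obtain ⟨D, hD, hx⟩ := exists_descendants N x
    have hmB := fun y => measurableSet_blockSurvives (d := e + 1) M N j y
    have hmR := fun y : TreeVertex (e + 1) => measurableSet_reach M y N
    have hlen : ∀ y ∈ D, N ≤ y.1.length := fun y hy => by rw [(hx y hy).2]; omega
    have hq : ∀ y : TreeVertex (e + 1), 0 < P.real (BlockSurvives M N j y) :=
      fun y => hs0.trans_le (ih y)
    -- Equality of the block probabilities at different y is not needed: the weight s divided by
    -- that probability brings each of them down to s, in the pair terms as well.
    have key := measureReal_biUnion_ge P D (fun y => Reach M y N ∩ BlockSurvives M N j y)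
      (fun y _ => (siteSigma_le _ _ (hmR y)).inter (siteSigma_le _ _ (hmB y)))
      (fun y => s / P.real (BlockSurvives M N j y)) (fun y _ => (div_pos hs0 (hq y)).le)
      (fun y _ => (div_le_one (hq y)).2 (ih y)) (fun _ => s * r) (s ^ 2) (by positivity)
      (fun y hy => by
        rw [frogLaw_real_inter ν p (disjoint_segment_cone y (hlen y hy)) (hmR y) (hmB y)]
        have h1 := hr y (hlen y hy)
        have h2 := (hq y).ne'
        field_simp
        gcongr)
      (fun y hy y' hy' hne => by
        -- Reaching y and reaching y' may use common sites, so these events are dropped; the blocks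
        -- behind y and y' live on disjoint cones.
        have hle : P.real ((Reach M y N ∩ BlockSurvives M N j y) ∩
            (Reach M y' N ∩ BlockSurvives M N j y')) ≤
            P.real (BlockSurvives M N j y) * P.real (BlockSurvives M N j y') := by
          rw [← frogLaw_real_inter ν p (disjoint_cone ?_ hne) (hmB y) (hmB y')]
          · exact measureReal_mono fun ω h => ⟨h.1.2, h.2.2⟩
          · rw [(hx y hy).2, (hx y' hy').2]
        have h1 := (hq y).ne'
        have h2 := (hq y').ne'
        calc _ ≤ s / P.real (BlockSurvives M N j y) * (s / P.real (BlockSurvives M N j y')) *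
              (P.real (BlockSurvives M N j y) * P.real (BlockSurvives M N j y')) := by
              refine mul_le_mul_of_nonneg_left hle ?_
              exact mul_nonneg (div_pos hs0 (hq y)).le (div_pos hs0 (hq y')).le
          _ = s ^ 2 := by field_simp)
    have hcard : (D.card : ℝ) = L := by rw [hD]; push_cast; rfl
    rw [Finset.sum_const, nsmul_eq_mul, hcard] at key
    have e1 : L * (s * r) - L ^ 2 * s ^ 2 = s := by
      rw [hs]; field_simp; ring
    rw [e1] at key
    refine key.trans (measureReal_mono ?_)
    exact Set.iUnion_mono fun y => Set.iUnion_mono' fun hy => ⟨hx y hy, le_rfl⟩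

/-- The block bound is independent of j and the events decrease in j, so continuity from above gives
all blocks at once. -/
theorem frogLaw_survives_pos {e : ℕ} (hp : p ≠ 1) (M N : ℕ) (hN : 0 < N)
    (hc : 0 ≤ effectiveMean ν p M (e + 1))
    (h : 1 < (e : ℝ) ^ N * (renewal (effectiveMean ν p M (e + 1)) N *
      ((p : ℝ) / (e + 1 : ℕ)) ^ N)) :
    0 < frogLaw (regTree (e + 1)) ν p {ω | Survives (treeRoot (e + 1)) ω} := by
  have hs := le_frogLaw_blockSurvives ν p M N _
    (fun y hy => le_frogLaw_reach ν p (Nat.succ_pos e) hp M y hc N hy) h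
  set s := ((e : ℝ) ^ N * (renewal (effectiveMean ν p M (e + 1)) N *
      ((p : ℝ) / (e + 1 : ℕ)) ^ N) - 1) / ((e : ℝ) ^ N) ^ 2 with hsdef
  have hs0 : 0 < s := by
    have : (0 : ℝ) < (e : ℝ) ^ N := lt_of_le_of_ne (by positivity) fun h' => by
      rw [← h'] at h; norm_num at h
    exact div_pos (by linarith) (by positivity)
  have hlim := tendsto_measure_iInter_atTop (μ := frogLaw (regTree (e + 1)) ν p)
    (s := fun j => BlockSurvives M N j (treeRoot (e + 1)))
    (fun j => (siteSigma_le _ _ (measurableSet_blockSurvives M N j _)).nullMeasurableSet)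
    (antitone_nat_of_succ_le fun j => blockSurvives_succ_subset M N j _)
    ⟨0, measure_ne_top _ _⟩
  have hge : ENNReal.ofReal s ≤
      frogLaw (regTree (e + 1)) ν p (⋂ j, BlockSurvives M N j (treeRoot (e + 1))) := by
    refine ge_of_tendsto' hlim fun j => ?_
    exact ENNReal.ofReal_le_of_le_toReal (hs j _)
  refine (ENNReal.ofReal_pos.2 hs0).trans_le (hge.trans (measure_mono_ae ?_))
  filter_upwards [ae_length_walk_le (Nat.succ_pos e) ν p] with ω hω hB
  exact survives_of_forall_blockSurvives hN hω (Set.mem_iInter.1 hB)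

end TreeEstimates

/-! ### The mean as a sum of tails, and large degree asymptotics -/

theorem tsum_measure_lt (ν : Measure ℕ) (hint : Integrable (fun n : ℕ => (n : ℝ)) ν) :
    ∑' i, ν {n | i < n} = ENNReal.ofReal (∫ n : ℕ, (n : ℝ) ∂ν) := by
  rw [ofReal_integral_eq_lintegral_ofReal hint (Eventually.of_forall fun n => Nat.cast_nonneg n)]
  have h : ∀ n : ℕ, ENNReal.ofReal (n : ℝ) =
      ∑' i, Set.indicator {n : ℕ | i < n} (fun _ => (1 : ℝ≥0∞)) n := by
    intro n
    rw [tsum_eq_sum (s := Finset.range n) (fun i hi => by simpa using hi),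
      Finset.sum_congr rfl (g := fun _ => (1 : ℝ≥0∞)) fun i hi =>
        Set.indicator_of_mem (show n ∈ {n : ℕ | i < n} from Finset.mem_range.1 hi) _]
    simp
  simp_rw [h]
  rw [lintegral_tsum fun i => Measurable.of_discrete.aemeasurable]
  simp [lintegral_indicator_const MeasurableSet.of_discrete]

theorem hasSum_measure_lt (ν : Measure ℕ) [IsProbabilityMeasure ν]
    (hint : Integrable (fun n : ℕ => (n : ℝ)) ν) :
    HasSum (fun i => ν.real {n | i < n}) (∫ n : ℕ, (n : ℝ) ∂ν) := by
  have h := tsum_measure_lt ν hint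
  have hne : ∑' i, ν {n | i < n} ≠ ∞ := by rw [h]; exact ENNReal.ofReal_ne_top
  have := ENNReal.hasSum_toReal hne
  rw [← ENNReal.tsum_toReal_eq fun i => measure_ne_top _ _, h,
    ENNReal.toReal_ofReal (integral_nonneg fun n => Nat.cast_nonneg n)] at this
  exact this

theorem tendsto_effectiveMean (ν : Measure ℕ) (p : unitInterval) (M : ℕ) :
    Tendsto (fun e : ℕ => effectiveMean ν p M (e + 1)) atTop
      (𝓝 (∑ i ∈ Finset.range M, ν.real {n | i < n})) := by
  have h : Tendsto (fun e : ℕ => (p : ℝ) / (e + 1 : ℕ)) atTop (𝓝 0) :=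
    (tendsto_const_div_atTop_nhds_zero_nat (p : ℝ)).comp (tendsto_add_atTop_nat 1)
  have := (h.const_mul ((M : ℝ) ^ 2 + M)).const_sub (∑ i ∈ Finset.range M, ν.real {n | i < n})
  rw [mul_zero, sub_zero] at this
  exact this

/-- The e^N descendants compensate the probability (e+1)^(-N) of the prescribed directions, since
e/(e+1) tends to one. -/
theorem tendsto_mean_descendants (ν : Measure ℕ) (p : unitInterval) (M : ℕ) {N : ℕ} (hN : 0 < N) :
    Tendsto (fun e : ℕ => (e : ℝ) ^ N * (renewal (effectiveMean ν p M (e + 1)) N *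
      ((p : ℝ) / (e + 1 : ℕ)) ^ N)) atTop
      (𝓝 ((p : ℝ) ^ N * ((∑ i ∈ Finset.range M, ν.real {n | i < n}) *
        (1 + ∑ i ∈ Finset.range M, ν.real {n | i < n}) ^ (N - 1)))) := by
  have h1 := tendsto_effectiveMean ν p M
  have h2 : Tendsto (fun e : ℕ => (e : ℝ) / ((e : ℝ) + 1)) atTop (𝓝 1) :=
    tendsto_natCast_div_add_atTop 1
  have h3 := ((h2.mul_const (p : ℝ)).pow N).mul (h1.mul ((h1.const_add 1).pow (N - 1)))
  rw [one_mul] at h3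
  refine h3.congr fun e => ?_
  rw [renewal, if_neg hN.ne']
  push_cast
  rw [div_mul_eq_mul_div, div_pow, div_pow, mul_pow]
  ring

/-- Survival has positive probability in large degrees above the limiting threshold. -/
theorem eventually_frogLaw_survives_pos (ν : Measure ℕ) [IsProbabilityMeasure ν]
    (hint : Integrable (fun n : ℕ => (n : ℝ)) ν) (p : unitInterval) (hp1 : p ≠ 1)
    (hp : 1 < (p : ℝ) * (1 + ∫ n : ℕ, (n : ℝ) ∂ν)) :
    ∀ᶠ e : ℕ in atTop,
      0 < frogLaw (regTree (e + 1)) ν p {ω | Survives (treeRoot (e + 1)) ω} := by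
  -- M is taken so large that the truncated mean c already satisfies p(1+c) > 1; next N is fixed,
  -- and only then does the degree grow.
  have hM := (((hasSum_measure_lt ν hint).tendsto_sum_nat.const_add 1).const_mul
    (p : ℝ)).eventually (lt_mem_nhds hp)
  obtain ⟨M, hM⟩ := hM.exists
  set c := ∑ i ∈ Finset.range M, ν.real {n | i < n} with hc
  have hp0 := p.2.1
  have hple := p.2.2
  have hc0 : 0 < c := by
    by_contra h
    push Not at h
    nlinarith
  -- This is p^N c (1+c)^(N-1), the limiting mean number of descendants reached, written as a
  -- geometric sequence.
  have hpow : Tendsto (fun N : ℕ => (c / (1 + c)) * ((p : ℝ) * (1 + c)) ^ N) atTop atTop :=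
    (tendsto_pow_atTop_atTop_of_one_lt hM).const_mul_atTop (by positivity)
  obtain ⟨N, hN, hN0⟩ := ((hpow.eventually_gt_atTop 1).and (eventually_gt_atTop 0)).exists
  have hlim : 1 < (p : ℝ) ^ N * (c * (1 + c) ^ (N - 1)) := by
    refine hN.trans_eq ?_
    obtain ⟨N, rfl⟩ : ∃ k, N = k + 1 := ⟨N - 1, by omega⟩
    rw [Nat.add_sub_cancel]
    field_simp
    rw [mul_pow]
    ring
  filter_upwards [(tendsto_effectiveMean ν p M).eventually (lt_mem_nhds hc0),
    (tendsto_mean_descendants ν p M hN0).eventually (lt_mem_nhds hlim)] with e h1 h2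
  exact frogLaw_survives_pos ν p hp1 M N hN0 h1.le h2

end FrogModel

end

/-! ### The limit of the critical probabilities -/

open FrogModel in
theorem theorem2p7 (ν : Measure ℕ) [IsProbabilityMeasure ν] (hpos : 0 < ν {n | 1 ≤ n})
    (hint : Integrable (fun n : ℕ => (n : ℝ)) ν) :
    Tendsto (fun d : ℕ => FrogModel.criticalProb (FrogModel.regTree d) (FrogModel.treeRoot d) ν)
      atTop (𝓝 (1 / (1 + ∫ n : ℕ, (n : ℝ) ∂ν))) := by
  set m := ∫ n : ℕ, (n : ℝ) ∂ν with hm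
  have hm0 : 0 < m := by
    have h0 : 0 < ν.real {n | 0 < n} := ENNReal.toReal_pos hpos.ne' (measure_ne_top _ _)
    exact h0.trans_le (le_hasSum (hasSum_measure_lt ν hint) 0 fun _ _ => measureReal_nonneg)
  have hlow : ∀ d : ℕ, ∀ r ∈ {r : ℝ | ∃ p : unitInterval, (p : ℝ) = r ∧
      0 < frogLaw (regTree d) ν p {ω | Survives (treeRoot d) ω}}, 1 / (1 + m) ≤ r := by
    rintro d r ⟨p, rfl, hp⟩
    by_contra h
    push Not at h
    rw [lt_div_iff₀ (by positivity)] at h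
    have hsum := tsum_measure_lt ν hint
    refine hp.ne' (frogLaw_survives_eq_zero (regTree d) ν p (treeRoot d) ?_ ?_)
    · rw [hsum]; exact ENNReal.ofReal_ne_top
    · rw [hsum, ← ENNReal.ofReal_one, ← ENNReal.ofReal_add zero_le_one hm0.le,
        ← ENNReal.ofReal_mul p.2.1]
      exact (ENNReal.ofReal_lt_ofReal_iff one_pos).2 h
  -- Now d = e + 1, with e the number of children used at each vertex.
  rw [← tendsto_add_atTop_iff_nat 1]
  have hup : ∀ r : ℝ, 1 / (1 + m) < r → r < 1 → ∀ᶠ e : ℕ in atTop,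
      r ∈ {r : ℝ | ∃ p : unitInterval, (p : ℝ) = r ∧
        0 < frogLaw (regTree (e + 1)) ν p {ω | Survives (treeRoot (e + 1)) ω}} := by
    intro r hr hr1
    have h0 : 0 ≤ r := by
      have : 0 < 1 / (1 + m) := by positivity
      linarith
    rw [div_lt_iff₀ (by positivity)] at hr
    have hne : (⟨r, h0, hr1.le⟩ : unitInterval) ≠ 1 := fun h =>
      hr1.ne (congrArg Subtype.val h)
    filter_upwards [eventually_frogLaw_survives_pos ν hint ⟨r, h0, hr1.le⟩ hne hr] with e he
    exact ⟨_, rfl, he⟩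
  have hlt1 : 1 / (1 + m) < 1 := by
    rw [div_lt_one (by positivity)]
    linarith
  refine tendsto_order.2 ⟨fun a ha => ?_, fun a ha => ?_⟩
  -- The real infimum of the empty set is 0, so the lower bound also needs some parameter with
  -- survival; one exists for large degree.
  · obtain ⟨r, hr, hr1⟩ := exists_between hlt1
    filter_upwards [hup r hr hr1] with e he
    exact ha.trans_le (le_csInf ⟨r, he⟩ (hlow (e + 1)))
  · obtain ⟨r, hr, hr1⟩ := exists_between (lt_min ha hlt1)
    filter_upwards [hup r hr (hr1.trans_le (min_le_right _ _))] with e he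
    exact (csInf_le ⟨_, hlow (e + 1)⟩ he).trans_lt (hr1.trans_le (min_le_left _ _))
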